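/- All graphs are simple and undirected. For a vertex $v$ of a graph $G$, local complementation at $v$ replaces the subgraph induced on the neighbours of $v$ by its complement; a vertex-minor of $G$ is an induced subgraph of a graph obtained from $G$ by a (finite) sequence of local complementations. For $n\ge 3$, $W_n$ is the wheel consisting of an induced cycle on $n$ vertices and one further vertex adjacent to all of them. For $S\subseteq V(G)$, $N_G(S)$ is the set of vertices outside $S$ having a neighbour in $S$. A $(w,\ell)$-patched cycle $(q_1q_2\cdots q_mq_1,S_1,\ldots,S_w)$, for positive integers $w,\ell$, is a graph whose vertex set is the union of the pairwise disjoint sets $\{q_1,\ldots,q_m\}$ and $S_i=\{s^i_1,\ldots,s^i_\ell\}$ ($1\le i\le w$), such that $q_1q_2\cdots q_mq_1$ is an induced cycle and there are indices $1\le b_1<b_2<\cdots<b_\ell\le m$ such that, for all $i\in\{1,\ldots,w\}$ and $j\in\{1,\ldots,\ell\}$, $s^i_j$ is adjacent to $q_{b_j}$ and non-adjacent to $q_{b_x}$ for every $x\in\{j+1,\ldots,\ell\}$. It is simple if $S_1\cup\cdots\cup S_w$ is an independent set. Proposition. For every integer $n\ge 3$ there exists a positive integer $M=M(n)$ with the following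 property. If $G$ is a graph obtained from a simple $(2,M)$-patched cycle $(q_1q_2\cdots q_mq_1,S_1,S_2)$ by adding disjoint vertex sets $T_1$ and $T_2$ such that - there are no edges between $\{q_1,\ldots,q_m\}$ and $T_1\cup T_2$, - there are no edges between $S_1$ and $T_2$, - for each $i\in\{1,2\}$, every vertex in $S_i$ has a neighbour in $T_i$, - for each $i\in\{1,2\}$, there is a vertex $r_i\in T_i$ such that for every $v\in N_G(S_i)\cap T_i$ there is a path $P$ from $v$ to $r_i$ in $G[T_i]$ with $N_G(S_i)\cap V(P)=\{v\}$, then $G$ contains a vertex-minor isomorphic to $W_n$. -/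

import Mathlib

namespace WheelVM

universe u v

/-- Local complementation `G * v`: the subgraph induced on the neighbours of `v` is replaced by
its complement. -/
def localComplement {V : Type u} (G : SimpleGraph V) (v : V) : SimpleGraph V where
  Adj a b := a ≠ b ∧ Xor (G.Adj a b) (G.Adj v a ∧ G.Adj v b)
  symm := ⟨fun a b h => by
    refine ⟨h.1.symm, ?_⟩
    rw [G.adj_comm b a, and_comm (a := G.Adj v b)]
    exact h.2⟩
  loopless := ⟨fun _ h => h.1 rfl⟩

/-- `G'` is obtained from `G` by a finite (possibly empty) sequence of local complementations. -/
def LocallyEquivalent {V : Type u} (G G' : SimpleGraph V) : Prop :=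
  Relation.ReflTransGen (fun G₁ G₂ : SimpleGraph V => ∃ v, G₂ = localComplement G₁ v) G G'

/-- `G` has a vertex-minor isomorphic to `H`: some graph locally equivalent to `G` has an induced
subgraph isomorphic to `H`. -/
def HasVertexMinor {V : Type u} {W : Type v} (G : SimpleGraph V) (H : SimpleGraph W) : Prop :=
  ∃ G' : SimpleGraph V, LocallyEquivalent G G' ∧ H.IsIndContained G'

/-- The wheel `W_n` (meaningful for `n ≥ 3`): a cycle on the `n` vertices `some i` and a hub
`none` adjacent to all of them. -/
def wheelGraph (n : ℕ) : SimpleGraph (Option (Fin n)) where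
  Adj
    | some i, some j => (SimpleGraph.cycleGraph n).Adj i j
    | some _, none => True
    | none, some _ => True
    | none, none => False
  symm := ⟨by
    rintro (_ | i) (_ | j) h
    · exact h
    · trivial
    · trivial
    · exact SimpleGraph.Adj.symm h⟩
  loopless := ⟨by
    rintro (_ | i) h
    · exact h
    · exact SimpleGraph.irrefl _ h⟩

/-- `N_G(S)`: the vertices outside `S` that have a neighbour in `S`. -/
def setNeighbors {V : Type u} (G : SimpleGraph V) (S : Set V) : Set V :=
  {v | v ∉ S ∧ ∃ x ∈ S, G.Adj x v}

/-- The graph `H` is a `(w, ℓ)`-patched cycle `(q_1 ⋯ q_m q_1, S_1, …, S_w)`, where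
`S_i = {s i j : j}` (indices start at `0`). -/
structure IsPatchedCycle {W : Type u} (H : SimpleGraph W) {m w ℓ : ℕ}
    (q : Fin m → W) (s : Fin w → Fin ℓ → W) : Prop where
  width_pos : 0 < w
  length_pos : 0 < ℓ
  cover : Set.range q ∪ ⋃ i, Set.range (s i) = Set.univ
  disjoint_cycle : ∀ i, Disjoint (Set.range q) (Set.range (s i))
  disjoint_patches : ∀ i j, i ≠ j → Disjoint (Set.range (s i)) (Set.range (s j))
  patch_injective : ∀ i, Function.Injective (s i)
  three_le : 3 ≤ m
  cycle_injective : Function.Injective q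
  cycle_adj : ∀ a b, H.Adj (q a) (q b) ↔ (SimpleGraph.cycleGraph m).Adj a b
  staircase : ∃ b : Fin ℓ → Fin m, StrictMono b ∧
    ∀ i j, H.Adj (s i j) (q (b j)) ∧ ∀ x, j < x → ¬ H.Adj (s i j) (q (b x))

/-- A patched cycle is simple if `S_1 ∪ ⋯ ∪ S_w` is an independent set. -/
structure IsSimplePatchedCycle {W : Type u} (H : SimpleGraph W) {m w ℓ : ℕ}
    (q : Fin m → W) (s : Fin w → Fin ℓ → W) : Prop extends IsPatchedCycle H q s where
  independent : H.IsIndepSet (⋃ i, Set.range (s i))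

/-- There is a root `r ∈ T` such that every `v ∈ N_G(S) ∩ T` is joined to `r` by a path `P` of
`G[T]` with `N_G(S) ∩ V(P) = {v}`. -/
def IsRootedAt {V : Type u} (G : SimpleGraph V) (S T : Set V) : Prop :=
  ∃ r ∈ T, ∀ v ∈ setNeighbors G S ∩ T, ∃ P : G.Walk v r, P.IsPath ∧
    (∀ x ∈ P.support, x ∈ T) ∧ setNeighbors G S ∩ {x | x ∈ P.support} = {v}

/-- `G` is obtained from a graph `H` containing the cycle `q` and the patches `S_1, S_2`
(`s 0` and `s 1`) by adding disjoint vertex sets `T_1, T_2` (`T 0` and `T 1`) with the prescribed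
adjacencies; `φ` is the inclusion of `H` in `G` as an induced subgraph. Edges inside `T_1`, inside
`T_2`, between `T_1` and `T_2`, and between `S_2` and `T_1` are otherwise arbitrary. -/
structure IsRootedExtension {W : Type u} {V : Type v} {H : SimpleGraph W} {G : SimpleGraph V}
    (φ : H ↪g G) {m ℓ : ℕ} (q : Fin m → W) (s : Fin 2 → Fin ℓ → W) (T : Fin 2 → Set V) :
    Prop where
  cover : Set.range φ ∪ (T 0 ∪ T 1) = Set.univ
  disjoint_old : ∀ i, Disjoint (Set.range φ) (T i)
  disjoint_new : Disjoint (T 0) (T 1)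
  not_adj_cycle : ∀ a i, ∀ t ∈ T i, ¬ G.Adj (φ (q a)) t
  not_adj_patch : ∀ j, ∀ t ∈ T 1, ¬ G.Adj (φ (s 0 j)) t
  patch_has_neighbor : ∀ i j, ∃ t ∈ T i, G.Adj (φ (s i j)) t
  rooted : ∀ i, IsRootedAt G (Set.range fun j => φ (s i j)) (T i)

end WheelVM

/-!
The wheel arises as an induced cycle together with a vertex, the hub, that has many neighbours on
it. A cycle vertex that is not a neighbour of the hub can be removed by a local complementation, and
removing spokes lowers their number by `3` or by `4`, so `n + 6` spokes suffice for `W_n`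
(`hasVertexMinor_wheelGraph`). In particular one may assume that no vertex of the patches has many
neighbours on the cycle `Q` of the patched cycle. There are two cases.

*No vertex of `T_1` has many neighbours in `S_1`.* A minimal subset of `T_1` dominating `S_1` then
contains large sets `X ⊆ T_1` and `S ⊆ S_1` that induce a matching (`exists_induced_matching`). The
paths to the root, without their first vertices, form a connected set `K ⊆ T_1` that dominates `X`
and has no neighbour in `S_1` or on `Q`. Local complementations inside `K` contract `K` to one
vertex `c` that is adjacent to a large part of `X` (`exists_locallyEquivalentOn_star`), and by
Ramsey's theorem this part can be made independent. Pivoting on an edge `x s` of the matching now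
adds the neighbourhood of `s` on `Q` to that of `c` and leaves `Q` intact. Since the adjacency
between the patch and the marked vertices of `Q` is triangular, pivoting on suitable edges of the
matching makes `c` the hub of `Q` (`exists_adj_of_pivots`). Neither `S_2` nor `T_2` is needed here.

The contraction of `K` is a minimality argument: vertices of `K` are removed, by deletion or by
local complementation followed by deletion, as long as `K` stays connected and dominates `X`. One of
the two always preserves connectedness (`ConnectedOn.erase_or`), so in the end every `x ∈ K` has a
neighbour in `X` that is either pendant at `x` or a true twin of `x` within `K`
(`exists_reduced`). If some vertex of `K` has large degree in `K`, a star is found near it;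
otherwise `K` contains a long induced path, and local complementation along the path accumulates
the attached vertices at its end (`localComplementSeq_adj_last`).

*Some `t ∈ T_1` has many neighbours in `S_1`.* A segment of `Q` is chosen on which the neighbourhoods
of many pairs `s^1_j, s^2_j` are separated from each other (`exists_separated`). The first and the
last of the vertices `s^2_j` are joined by an induced path through `T_2`, which closes the segment
to an induced cycle. Nothing on this closing path is adjacent to `S_1`. The vertices `s^1_j` between
are legs from `t` to the segment, and each of them can be converted into a spoke at `t`
(`exists_hub_of_legs`); whether `t` has neighbours on the closing path is irrelevant.
-/

namespace WheelVM

universe u v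

/-! ### Local complementation -/

section Local

variable {V : Type u} {G G' : SimpleGraph V}

theorem localComplement_adj {v a b : V} :
    (localComplement G v).Adj a b ↔ a ≠ b ∧ Xor (G.Adj a b) (G.Adj v a ∧ G.Adj v b) :=
  Iff.rfl

theorem localComplement_adj_of_not_left {v a b : V} (h : ¬ G.Adj v a) :
    (localComplement G v).Adj a b ↔ G.Adj a b := by
  rw [localComplement_adj]
  constructor
  · rintro ⟨_, h'⟩
    simpa [Xor, h] using h'
  · intro h'
    exact ⟨h'.ne, by simpa [Xor, h] using h'⟩

theorem localComplement_adj_of_not_right {v a b : V} (h : ¬ G.Adj v b) :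
    (localComplement G v).Adj a b ↔ G.Adj a b := by
  rw [SimpleGraph.adj_comm, localComplement_adj_of_not_left h, SimpleGraph.adj_comm]

theorem localComplement_adj_of_adj {v a b : V} (hab : a ≠ b) (ha : G.Adj v a) (hb : G.Adj v b) :
    (localComplement G v).Adj a b ↔ ¬ G.Adj a b := by
  simp [localComplement_adj, Xor, hab, ha, hb]

theorem localComplement_adj_self_left {v b : V} :
    (localComplement G v).Adj v b ↔ G.Adj v b :=
  localComplement_adj_of_not_left G.irrefl

/-- `G'` arises from `G` by local complementations at vertices of `K`. -/
def LocallyEquivalentOn (K : Set V) (G G' : SimpleGraph V) : Prop :=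
  Relation.ReflTransGen (fun G₁ G₂ : SimpleGraph V => ∃ v ∈ K, G₂ = localComplement G₁ v) G G'

namespace LocallyEquivalentOn

variable {K K' : Set V} {G'' : SimpleGraph V}

theorem refl (K : Set V) (G : SimpleGraph V) : LocallyEquivalentOn K G G :=
  Relation.ReflTransGen.refl

theorem trans (h : LocallyEquivalentOn K G G') (h' : LocallyEquivalentOn K G' G'') :
    LocallyEquivalentOn K G G'' :=
  Relation.ReflTransGen.trans h h'

theorem single {v : V} (hv : v ∈ K) : LocallyEquivalentOn K G (localComplement G v) :=
  Relation.ReflTransGen.single ⟨v, hv, rfl⟩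

theorem mono (hK : K ⊆ K') (h : LocallyEquivalentOn K G G') : LocallyEquivalentOn K' G G' :=
  Relation.ReflTransGen.mono (fun _ _ ⟨v, hv, e⟩ => ⟨v, hK hv, e⟩) _ _ h

theorem locallyEquivalent (h : LocallyEquivalentOn K G G') : LocallyEquivalent G G' :=
  Relation.ReflTransGen.mono (fun _ _ ⟨v, _, e⟩ => ⟨v, e⟩) _ _ h

/-- Local complementations inside `K` do not change the neighbourhood of a vertex that has no
neighbour in `K`. -/
theorem adj_iff (h : LocallyEquivalentOn K G G') {a : V} (ha : ∀ v ∈ K, ¬ G.Adj v a) (b : V) :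
    G'.Adj a b ↔ G.Adj a b := by
  induction h generalizing b with
  | refl => rfl
  | tail _ hstep ih =>
    obtain ⟨v, hv, rfl⟩ := hstep
    have hva : ¬ SimpleGraph.Adj _ v a := fun hva => ha v hv ((ih v).1 hva.symm).symm
    rw [localComplement_adj_of_not_left hva, ih]

end LocallyEquivalentOn

theorem LocallyEquivalent.single (v : V) : LocallyEquivalent G (localComplement G v) :=
  Relation.ReflTransGen.single ⟨v, rfl⟩

theorem HasVertexMinor.of_locallyEquivalent {W : Type v} {H : SimpleGraph W}
    (h : LocallyEquivalent G G') (h' : HasVertexMinor G' H) : HasVertexMinor G H := by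
  obtain ⟨G'', h₁, h₂⟩ := h'
  exact ⟨G'', Relation.ReflTransGen.trans h h₁, h₂⟩

end Local

/-! ### Cycles with a hub -/

section Cycle

variable {V : Type u} {G : SimpleGraph V}

/-- The vertices `c 0, …, c (m - 1)` form, in this cyclic order, an induced cycle of `G`; the
values of `c` from `m` on are irrelevant. -/
structure IsInducedCycle (G : SimpleGraph V) (m : ℕ) (c : ℕ → V) : Prop where
  three_le : 3 ≤ m
  inj : ∀ {i j}, i < m → j < m → (c i = c j ↔ i = j)
  adj : ∀ {i j}, i < m → j < m →
    (G.Adj (c i) (c j) ↔ i + 1 = j ∨ j + 1 = i ∨ (i = 0 ∧ j + 1 = m) ∨ (j = 0 ∧ i + 1 = m))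

theorem IsInducedCycle.of_lt {m : ℕ} {c : ℕ → V} (hm : 3 ≤ m)
    (hne : ∀ i j, i < j → j < m → c i ≠ c j)
    (hadj : ∀ i j, i < j → j < m → (G.Adj (c i) (c j) ↔ i + 1 = j ∨ (i = 0 ∧ j + 1 = m))) :
    IsInducedCycle G m c := by
  refine ⟨hm, ?_, ?_⟩
  · intro i j hi hj
    refine ⟨fun h => ?_, fun h => h ▸ rfl⟩
    rcases lt_trichotomy i j with hij | hij | hij
    · exact absurd h (hne i j hij hj)
    · exact hij
    · exact absurd h.symm (hne j i hij hi)
  · intro i j hi hj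
    rcases lt_trichotomy i j with hij | rfl | hij
    · rw [hadj i j hij hj]; omega
    · simp only [SimpleGraph.irrefl, false_iff]; omega
    · rw [G.adj_comm, hadj j i hij hi]; omega

/-- Local complementation at a vertex of an induced cycle, followed by the deletion of that vertex,
leaves an induced cycle. -/
theorem IsInducedCycle.remove {m k : ℕ} {c : ℕ → V} (hc : IsInducedCycle G m c) (hm : 4 ≤ m)
    (hk : k < m) :
    IsInducedCycle (localComplement G (c k)) (m - 1) (fun i => c (if i < k then i else i + 1)) := by
  have e : ∀ i, i < m - 1 → (if i < k then i else i + 1) < m := by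
    intro i hi; split_ifs <;> omega
  have e' : ∀ i j, i < j → (if i < k then i else i + 1) < (if j < k then j else j + 1) := by
    intro i j hij; split_ifs <;> omega
  refine .of_lt (by omega) ?_ ?_
  · intro i j hij hj
    rw [Ne, hc.inj (e i (by omega)) (e j hj)]
    exact (e' i j hij).ne
  · intro i j hij hj
    have hi : i < m - 1 := by omega
    rw [localComplement_adj, Ne, hc.inj (e i hi) (e j hj), hc.adj (e i hi) (e j hj),
      hc.adj hk (e i hi), hc.adj hk (e j hj)]
    unfold Xor
    clear e e'
    obtain ⟨m, rfl⟩ : ∃ m', m = m' + 1 := ⟨m - 1, by omega⟩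
    split_ifs <;> first | omega | grind

open Classical in
/-- The number of neighbours of `h` on the cycle `c 0, …, c (m - 1)`. -/
noncomputable def hubDegree (G : SimpleGraph V) (h : V) (m : ℕ) (c : ℕ → V) : ℕ :=
  ((Finset.range m).filter fun i => G.Adj h (c i)).card

theorem cycleGraph_adj_iff {n : ℕ} (hn : 3 ≤ n) (i j : Fin n) :
    (SimpleGraph.cycleGraph n).Adj i j ↔ (i : ℕ) + 1 = j ∨ (j : ℕ) + 1 = i ∨
      ((i : ℕ) = 0 ∧ (j : ℕ) + 1 = n) ∨ ((j : ℕ) = 0 ∧ (i : ℕ) + 1 = n) := by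
  rw [SimpleGraph.cycleGraph_adj']
  rcases i with ⟨i, hi⟩
  rcases j with ⟨j, hj⟩
  dsimp only at *
  have key : ∀ {a b : ℕ} (ha : a < n) (hb : b < n),
      (((⟨a, ha⟩ : Fin n) - ⟨b, hb⟩ : Fin n) : ℕ) = if b ≤ a then a - b else n + a - b := by
    intro a b ha hb
    split_ifs with hab
    · exact Fin.sub_val_of_le hab
    · exact Fin.coe_sub_iff_lt.2 (not_le.1 hab)
  rw [key, key]
  split_ifs <;> omega

/-- The rim of a wheel on `n` spokes, read off an induced cycle all of whose vertices are adjacent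
to `h`. -/
theorem hasVertexMinor_of_isInducedCycle {n : ℕ} {c : ℕ → V} {h : V}
    (hc : IsInducedCycle G n c) (hh : ∀ i < n, G.Adj h (c i)) :
    HasVertexMinor G (wheelGraph n) := by
  refine ⟨G, Relation.ReflTransGen.refl, ⟨⟨⟨fun o => o.elim h fun i => c i, ?_⟩, ?_⟩⟩⟩
  · rintro (_ | i) (_ | j) hij
    · rfl
    · exact absurd hij (hh j j.2).ne
    · exact absurd hij.symm (hh i i.2).ne
    · have := (hc.inj i.2 j.2).1 hij
      exact congrArg some (Fin.ext this)
  · rintro (_ | i) (_ | j)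
    · simp [wheelGraph]
    · exact iff_of_true (hh j j.2) trivial
    · exact iff_of_true (hh i i.2).symm trivial
    · exact (hc.adj i.2 j.2).trans (cycleGraph_adj_iff hc.three_le i j).symm

/-- How the neighbourhood of the hub changes when the cycle vertex `c k` is removed as in
`IsInducedCycle.remove`: the two cycle neighbours of `c k` are toggled if `c k` is a spoke. -/
theorem IsInducedCycle.remove_hub_adj {m k i : ℕ} {c : ℕ → V} {h : V} (hc : IsInducedCycle G m c)
    (hk : k < m) (hi : i < m) (hh : ∀ i < m, h ≠ c i) :
    (localComplement G (c k)).Adj h (c i) ↔ Xor (G.Adj h (c i)) (G.Adj h (c k) ∧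
      (k + 1 = i ∨ i + 1 = k ∨ (k = 0 ∧ i + 1 = m) ∨ (i = 0 ∧ k + 1 = m))) := by
  rw [localComplement_adj, hc.adj hk hi, G.adj_comm (c k) h]
  simp [hh i hi]

theorem hubDegree_remove_of_not_adj {m k : ℕ} {c : ℕ → V} {h : V} (hc : IsInducedCycle G m c)
    (hk : k < m) (hh : ∀ i < m, h ≠ c i) (hn : ¬ G.Adj h (c k)) :
    hubDegree (localComplement G (c k)) h (m - 1) (fun i => c (if i < k then i else i + 1)) =
      hubDegree G h m c := by
  classical
  unfold hubDegree
  refine Finset.card_bij (fun i _ => if i < k then i else i + 1) ?_ ?_ ?_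
  · intro i hi
    simp only [Finset.mem_filter, Finset.mem_range] at hi ⊢
    have e : (if i < k then i else i + 1) < m := by split_ifs <;> omega
    rw [hc.remove_hub_adj hk e hh] at hi
    refine ⟨e, ?_⟩
    simpa [Xor, hn] using hi.2
  · intro i _ j _ hij
    grind
  · intro j hj
    simp only [Finset.mem_filter, Finset.mem_range] at hj
    have hjk : j ≠ k := by rintro rfl; exact hn hj.2
    have e : (if (if j < k then j else j - 1) < k then (if j < k then j else j - 1)
        else (if j < k then j else j - 1) + 1) = j := by split_ifs <;> omega
    refine ⟨if j < k then j else j - 1, ?_, e⟩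
    simp only [Finset.mem_filter, Finset.mem_range]
    refine ⟨by split_ifs <;> omega, ?_⟩
    rw [e, hc.remove_hub_adj hk hj.1 hh]
    simpa [Xor, hn] using hj.2

/-- A vertex with many neighbours on an induced cycle yields a wheel. Non-spokes of the cycle can
be removed; from a wheel with `d` spokes, removing one rim vertex leaves `d - 3` spokes and
removing two suitable rim vertices leaves `d - 4` spokes. -/
theorem hasVertexMinor_wheelGraph {n : ℕ} (hn : 3 ≤ n) {m : ℕ} {c : ℕ → V} {h : V}
    (hc : IsInducedCycle G m c) (hh : ∀ i < m, h ≠ c i)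
    (hd : hubDegree G h m c = n ∨ hubDegree G h m c = n + 3 ∨ hubDegree G h m c = n + 4 ∨
      n + 6 ≤ hubDegree G h m c) :
    HasVertexMinor G (wheelGraph n) := by
  classical
  induction m using Nat.strong_induction_on generalizing G c with
  | _ m ih =>
  have hle : hubDegree G h m c ≤ m := by
    simpa [hubDegree] using Finset.card_filter_le (Finset.range m) fun i => G.Adj h (c i)
  have hm3 := hc.three_le
  by_cases hall : ∀ i < m, G.Adj h (c i)
  · have hdeg : hubDegree G h m c = m := by
      rw [hubDegree, Finset.filter_true_of_mem (by simpa using hall), Finset.card_range]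
    rw [hdeg] at hd
    by_cases hmn : m = n
    · subst hmn
      exact hasVertexMinor_of_isInducedCycle hc hall
    have hc₁ := hc.remove (k := 0) (by omega) (by omega)
    set G₁ := localComplement G (c 0)
    set c₁ : ℕ → V := fun i => c (if i < 0 then i else i + 1) with hc₁_def
    have hh₁ : ∀ i < m - 1, h ≠ c₁ i := fun i hi => hh _ (by split_ifs <;> omega)
    have hadj₁ : ∀ i < m - 1, (G₁.Adj h (c₁ i) ↔ i ≠ 0 ∧ i + 2 ≠ m) := by
      intro i hi
      simp only [hc₁_def, not_lt_zero, if_false]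
      rw [hc.remove_hub_adj (by omega) (by omega) hh]
      simp only [hall 0 (by omega), hall (i + 1) (by omega), Xor]
      grind
    by_cases hm4 : m = n + 4 ∨ m = n + 8
    · have hc₂ := hc₁.remove (k := 1) (by omega) (by omega)
      refine HasVertexMinor.of_locallyEquivalent (LocallyEquivalent.single (c 0))
        (HasVertexMinor.of_locallyEquivalent (LocallyEquivalent.single (c₁ 1))
          (ih (m - 1 - 1) (by omega) hc₂
            (fun i hi => hh₁ _ (by split_ifs <;> omega)) ?_))
      suffices H : hubDegree (localComplement G₁ (c₁ 1)) h (m - 1 - 1)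
          (fun i => c₁ (if i < 1 then i else i + 1)) = m - 4 by rw [H]; omega
      have : (Finset.range (m - 1 - 1)).filter (fun i => (localComplement G₁ (c₁ 1)).Adj h
          (c₁ (if i < 1 then i else i + 1))) = insert 0 (Finset.Ico 2 (m - 3)) := by
        ext i
        simp only [Finset.mem_filter, Finset.mem_range, Finset.mem_insert, Finset.mem_Ico]
        by_cases hi : i < m - 1 - 1
        · have e : (if i < 1 then i else i + 1) < m - 1 := by split_ifs <;> omega
          rw [hc₁.remove_hub_adj (by omega) e hh₁, hadj₁ _ e, hadj₁ 1 (by omega)]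
          unfold Xor
          grind
        · omega
      rw [hubDegree, this, Finset.card_insert_of_notMem (by simp), Nat.card_Ico]
      omega
    · refine HasVertexMinor.of_locallyEquivalent (LocallyEquivalent.single (c 0))
        (ih (m - 1) (by omega) hc₁ hh₁ ?_)
      suffices H : hubDegree G₁ h (m - 1) c₁ = m - 3 by rw [H]; omega
      have : (Finset.range (m - 1)).filter (fun i => G₁.Adj h (c₁ i)) =
          Finset.Ico 1 (m - 2) := by
        ext i
        simp only [Finset.mem_filter, Finset.mem_range, Finset.mem_Ico]
        by_cases hi : i < m - 1
        · rw [hadj₁ i hi]; omega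
        · omega
      rw [hubDegree, this, Nat.card_Ico]
      omega
  · push Not at hall
    obtain ⟨k, hk, hnk⟩ := hall
    have hlt : hubDegree G h m c < m := by
      have : (Finset.range m).filter (fun i => G.Adj h (c i)) ⊂ Finset.range m :=
        Finset.filter_ssubset.2 ⟨k, by simpa using hk, hnk⟩
      simpa [hubDegree] using Finset.card_lt_card this
    refine HasVertexMinor.of_locallyEquivalent (LocallyEquivalent.single (c k))
      (ih (m - 1) (by omega) (hc.remove (by omega) hk)
        (fun i hi => hh _ (by split_ifs <;> omega)) ?_)
    rw [hubDegree_remove_of_not_adj hc hk hh hnk]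
    exact hd

end Cycle

/-! ### Ramsey's theorem for graphs, and geodesics -/

section Auxiliary

variable {V : Type u} (G : SimpleGraph V)

theorem exists_clique_or_independent (n : ℕ) :
    ∀ (a b : ℕ), a + b = n → ∀ s : Finset V, 2 ^ n ≤ s.card →
      (∃ t ⊆ s, t.card = a ∧ ∀ x ∈ t, ∀ y ∈ t, x ≠ y → G.Adj x y) ∨
      (∃ t ⊆ s, t.card = b ∧ ∀ x ∈ t, ∀ y ∈ t, ¬ G.Adj x y) := by
  classical
  induction n with
  | zero =>
    intro a b hab s _
    exact Or.inl ⟨∅, by simp, by simp; omega, by simp⟩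
  | succ n ih =>
    intro a b hab s hs
    rcases Nat.eq_zero_or_pos a with rfl | ha
    · exact Or.inl ⟨∅, by simp, by simp, by simp⟩
    rcases Nat.eq_zero_or_pos b with rfl | hb
    · exact Or.inr ⟨∅, by simp, by simp, by simp⟩
    have hpos : 0 < 2 ^ n := by positivity
    rw [pow_succ] at hs
    obtain ⟨v, hv⟩ : s.Nonempty := Finset.card_pos.1 (by omega)
    have hcard := Finset.card_erase_of_mem hv
    have hsplit := Finset.card_filter_add_card_filter_not (s := s.erase v) (G.Adj v)
    by_cases hbig : 2 ^ n ≤ ((s.erase v).filter (G.Adj v)).card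
    · rcases ih (a - 1) b (by omega) _ hbig with ⟨t, hts, htc, ht⟩ | ⟨t, hts, htc, ht⟩
      · have hvt : v ∉ t := fun h => by simpa using hts h
        refine Or.inl ⟨insert v t, ?_, ?_, ?_⟩
        · intro x hx
          rcases Finset.mem_insert.1 hx with rfl | hx
          · exact hv
          · exact Finset.mem_of_mem_erase (Finset.mem_filter.1 (hts hx)).1
        · rw [Finset.card_insert_of_notMem hvt]; omega
        · intro x hx y hy hxy
          rcases Finset.mem_insert.1 hx with rfl | hx' <;>
            rcases Finset.mem_insert.1 hy with rfl | hy'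
          · exact absurd rfl hxy
          · exact (Finset.mem_filter.1 (hts hy')).2
          · exact (Finset.mem_filter.1 (hts hx')).2.symm
          · exact ht x hx' y hy' hxy
      · exact Or.inr ⟨t, fun x hx => Finset.mem_of_mem_erase (Finset.mem_filter.1 (hts hx)).1,
          htc, ht⟩
    · have hbig' : 2 ^ n ≤ ((s.erase v).filter fun x => ¬ G.Adj v x).card := by omega
      rcases ih a (b - 1) (by omega) _ hbig' with ⟨t, hts, htc, ht⟩ | ⟨t, hts, htc, ht⟩
      · exact Or.inl ⟨t, fun x hx => Finset.mem_of_mem_erase (Finset.mem_filter.1 (hts hx)).1,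
          htc, ht⟩
      · have hvt : v ∉ t := fun h => by simpa using hts h
        refine Or.inr ⟨insert v t, ?_, ?_, ?_⟩
        · intro x hx
          rcases Finset.mem_insert.1 hx with rfl | hx
          · exact hv
          · exact Finset.mem_of_mem_erase (Finset.mem_filter.1 (hts hx)).1
        · rw [Finset.card_insert_of_notMem hvt]; omega
        · intro x hx y hy
          rcases Finset.mem_insert.1 hx with rfl | hx' <;>
            rcases Finset.mem_insert.1 hy with rfl | hy'
          · exact G.irrefl
          · exact (Finset.mem_filter.1 (hts hy')).2
          · exact fun h => (Finset.mem_filter.1 (hts hx')).2 h.symm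
          · exact ht x hx' y hy'

variable {G}

/-- A geodesic is an induced path. -/
theorem exists_induced_path {a b : V} (h : G.Reachable a b) :
    ∃ p : ℕ → V, p 0 = a ∧ p (G.dist a b) = b ∧
      ∀ i j, i < j → j ≤ G.dist a b → p i ≠ p j ∧ (G.Adj (p i) (p j) ↔ i + 1 = j) := by
  obtain ⟨w, hw⟩ := h.exists_walk_length_eq_dist
  have hshort : ∀ i j, i < j → j ≤ G.dist a b →
      ∀ q : G.Walk (w.getVert i) (w.getVert j), i + q.length ≥ j := by
    intro i j hij hj q
    have := G.dist_le ((w.take i).append (q.append (w.drop j)))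
    simp only [SimpleGraph.Walk.length_append, SimpleGraph.Walk.take_length,
      SimpleGraph.Walk.drop_length] at this
    omega
  refine ⟨w.getVert, w.getVert_zero, by rw [← hw]; exact w.getVert_length, ?_⟩
  intro i j hij hj
  refine ⟨fun he => ?_, fun he => ?_, ?_⟩
  · have := hshort i j hij hj (SimpleGraph.Walk.nil.copy rfl he)
    simp at this
    omega
  · have := hshort i j hij hj he.toWalk
    simp at this
    omega
  · rintro rfl
    exact w.adj_getVert_succ (by omega)

theorem exists_dist_gt [Fintype V] [DecidableRel G.Adj] (hG : G.Connected) {d l : ℕ} (r : V)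
    (hd : ∀ x, (Finset.univ.filter fun y => G.Adj x y).card ≤ d)
    (hc : (d + 1) ^ l < Fintype.card V) : ∃ x, l < G.dist r x := by
  classical
  have hball : ∀ l, (Finset.univ.filter fun x => G.dist r x ≤ l).card ≤ (d + 1) ^ l := by
    intro l
    induction l with
    | zero =>
      have : (Finset.univ.filter fun x => G.dist r x ≤ 0) ⊆ {r} := by
        intro x hx
        simp only [Finset.mem_filter, nonpos_iff_eq_zero] at hx
        simpa using ((hG r x).dist_eq_zero_iff.1 hx.2).symm
      simpa using Finset.card_le_card this
    | succ l ih =>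
      have hsub : (Finset.univ.filter fun x => G.dist r x ≤ l + 1) ⊆
          (Finset.univ.filter fun x => G.dist r x ≤ l).biUnion
            fun y => insert y (Finset.univ.filter fun z => G.Adj y z) := by
        intro x hx
        simp only [Finset.mem_filter, Finset.mem_univ, true_and] at hx
        simp only [Finset.mem_biUnion, Finset.mem_filter, Finset.mem_univ, true_and,
          Finset.mem_insert]
        by_cases hxl : G.dist r x ≤ l
        · exact ⟨x, hxl, Or.inl rfl⟩
        obtain ⟨w, hw⟩ := hG.exists_walk_length_eq_dist r x
        refine ⟨w.getVert l, ?_, Or.inr ?_⟩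
        · refine (G.dist_le (w.take l)).trans ?_
          simp
        · have := w.adj_getVert_succ (i := l) (by omega)
          rwa [w.getVert_of_length_le (i := l + 1) (by omega)] at this
      calc _ ≤ _ := Finset.card_le_card hsub
        _ ≤ (Finset.univ.filter fun x => G.dist r x ≤ l).card * (d + 1) :=
          Finset.card_biUnion_le_card_mul _ _ _ fun y _ =>
            (Finset.card_insert_le _ _).trans (Nat.succ_le_succ (hd y))
        _ ≤ (d + 1) ^ l * (d + 1) := Nat.mul_le_mul_right _ ih
        _ = _ := (pow_succ _ _).symm
  by_contra! h
  have := hball l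
  rw [Finset.filter_true_of_mem fun x _ => h x, Finset.card_univ] at this
  omega

end Auxiliary

/-! ### Connected vertex sets -/

section Connected

variable {V : Type u} {G : SimpleGraph V}

/-- The finite set `K` induces a connected subgraph of `G`, expressed by cuts: there is an edge
between any nonempty proper subset of `K` and the rest of `K`. The empty set qualifies. -/
def ConnectedOn (G : SimpleGraph V) (K : Finset V) : Prop :=
  ∀ A ⊆ K, A.Nonempty → A ≠ K → ∃ a ∈ A, ∃ b ∈ K, b ∉ A ∧ G.Adj a b

theorem ConnectedOn.connected_induce {K : Finset V} (h : ConnectedOn G K) (hK : K.Nonempty) :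
    (G.induce (K : Set V)).Connected := by
  classical
  have : Nonempty (K : Set V) := hK.to_subtype
  refine SimpleGraph.Connected.mk ?_
  intro x y
  by_contra hxy
  let A := K.filter fun z => ∃ hz : z ∈ (K : Set V), (G.induce (K : Set V)).Reachable x ⟨z, hz⟩
  obtain ⟨a, ha, b, hb, hbA, hab⟩ := h A (Finset.filter_subset _ _)
    ⟨x, Finset.mem_filter.2 ⟨x.2, x.2, SimpleGraph.Reachable.refl _⟩⟩ (by
      intro hA
      have hy : (y : V) ∈ A := by rw [hA]; exact y.2
      exact hxy (Finset.mem_filter.1 hy).2.2)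
  obtain ⟨haK, hxa⟩ := (Finset.mem_filter.1 ha).2
  refine hbA (Finset.mem_filter.2 ⟨hb, hb, hxa.trans ?_⟩)
  exact SimpleGraph.Adj.reachable (show G.Adj a b from hab)

variable [DecidableEq V]

/-- Deleting a vertex from a connected graph leaves a connected graph, possibly after a local
complementation at that vertex. -/
theorem ConnectedOn.erase_or {K : Finset V} (h : ConnectedOn G K) {x : V} (hx : x ∈ K) :
    ConnectedOn G (K.erase x) ∨ ConnectedOn (localComplement G x) (K.erase x) := by
  by_contra hcon
  rw [not_or] at hcon
  obtain ⟨h₁, h₂⟩ := hcon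
  simp only [ConnectedOn, not_forall, not_exists, not_and] at h₁ h₂
  obtain ⟨A, hA, hAne, hAK, hsepA⟩ := h₁
  obtain ⟨C, hC, hCne, hCK, hsepC⟩ := h₂
  -- every part of a partition of `K \ {x}` without crossing edges contains a neighbour of `x`
  have key : ∀ D ⊆ K.erase x, D.Nonempty → (∀ a ∈ D, ∀ b ∈ K.erase x, b ∉ D →
      ¬ G.Adj x a → ¬ G.Adj a b) → ∃ a ∈ D, G.Adj x a := by
    intro D hD hDne hsep
    obtain ⟨a, ha, b, hb, hbD, hab⟩ := h D (hD.trans (Finset.erase_subset _ _)) hDne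
      (fun e => by simpa using hD (e ▸ hx : x ∈ D))
    by_cases hbx : b = x
    · exact ⟨a, ha, hbx ▸ hab.symm⟩
    · by_contra hno
      push Not at hno
      exact hsep a ha b (Finset.mem_erase.2 ⟨hbx, hb⟩) hbD (hno a ha) hab
  have compl : ∀ D ⊆ K.erase x, D ≠ K.erase x → (K.erase x \ D).Nonempty := by
    intro D hD hne
    rw [Finset.sdiff_nonempty]
    exact fun h' => hne (hD.antisymm h')
  obtain ⟨a, haA, hxa⟩ := key A hA hAne fun a ha b hb hbA _ => hsepA a ha b hb hbA
  obtain ⟨b, hbA, hxb⟩ := key (K.erase x \ A) Finset.sdiff_subset (compl A hA hAK) (by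
    intro b hb a ha ha' _ hab
    rw [Finset.mem_sdiff] at hb ha'
    exact hsepA a (by_contra fun h' => ha' ⟨ha, h'⟩) b hb.1 hb.2 hab.symm)
  obtain ⟨c, hcC, hxc⟩ := key C hC hCne (by
    intro a ha b hb hbC hxa hab
    exact hsepC a ha b hb hbC ((localComplement_adj_of_not_left hxa).2 hab))
  obtain ⟨d, hdC, hxd⟩ := key (K.erase x \ C) Finset.sdiff_subset (compl C hC hCK) (by
    intro b hb a ha ha' hxb hab
    rw [Finset.mem_sdiff] at hb ha'
    exact hsepC a (by_contra fun h' => ha' ⟨ha, h'⟩) b hb.1 hb.2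
      ((localComplement_adj_of_not_right hxb).2 hab.symm))
  have cross : ∀ c ∈ C, ∀ d ∈ K.erase x, d ∉ C → G.Adj x c → G.Adj x d → G.Adj c d := by
    intro c hc d hd hdC hxc hxd
    by_contra hcd
    exact hsepC c hc d hd hdC
      ((localComplement_adj_of_adj (by rintro rfl; exact hdC hc) hxc hxd).2 hcd)
  have crossA : ∀ y ∈ K.erase x, ∀ z ∈ K.erase x, G.Adj y z → (y ∈ A ↔ z ∈ A) := by
    intro y hy z hz hyz
    constructor
    · intro hyA
      by_contra hzA
      exact hsepA y hyA z hz hzA hyz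
    · intro hzA
      by_contra hyA
      exact hsepA z hzA y hy hyA hyz.symm
  rw [Finset.mem_sdiff] at hbA hdC
  have hcd := crossA c (hC hcC) d hdC.1 (cross c hcC d hdC.1 hdC.2 hxc hxd)
  -- a neighbour of `x` on either side of `C` is adjacent to `c` or `d`, hence on their side of `A`
  have side : ∀ y ∈ K.erase x, G.Adj x y → (y ∈ A ↔ c ∈ A) := by
    intro y hy hxy
    by_cases hyC : y ∈ C
    · rw [hcd]
      exact crossA y hy d hdC.1 (cross y hyC d hdC.1 hdC.2 hxy hxd)
    · exact (crossA c (hC hcC) y hy (cross c hcC y hy hyC hxc hxy)).symm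
  exact hbA.2 ((side b hbA.1 hxb).2 ((side a (hA haA) hxa).1 haA))

theorem ConnectedOn.erase_of_twin {K : Finset V} (h : ConnectedOn G K) {x y : V}
    (hy : y ∈ K) (hxy : x ≠ y)
    (ht : ∀ z ∈ K, z ≠ x → z ≠ y → (G.Adj x z ↔ G.Adj y z)) : ConnectedOn G (K.erase x) := by
  by_cases hx : x ∈ K
  swap
  · rwa [Finset.erase_eq_of_notMem hx]
  by_contra hcon
  simp only [ConnectedOn, not_forall, not_exists, not_and] at hcon
  obtain ⟨A, hA, hAne, hAK, hsep⟩ := hcon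
  -- the side of the partition that does not contain `y`
  have key : ∀ D ⊆ K.erase x, D.Nonempty → y ∉ D →
      ∃ a ∈ D, ∃ b ∈ K.erase x, b ∉ D ∧ G.Adj a b := by
    intro D hD hDne hyD
    obtain ⟨a, ha, b, hb, hbD, hab⟩ := h D (hD.trans (Finset.erase_subset _ _)) hDne
      (fun e => by simpa using hD (e ▸ hx : x ∈ D))
    by_cases hbx : b = x
    · have ha' := Finset.mem_erase.1 (hD ha)
      subst hbx
      exact ⟨a, ha, y, Finset.mem_erase.2 ⟨hxy.symm, hy⟩, hyD,
        ((ht a ha'.2 ha'.1 (fun e => hyD (e ▸ ha))).1 hab.symm).symm⟩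
    · exact ⟨a, ha, b, Finset.mem_erase.2 ⟨hbx, hb⟩, hbD, hab⟩
  by_cases hyA : y ∈ A
  · obtain ⟨b, hb, a, ha, haD, hab⟩ := key (K.erase x \ A) Finset.sdiff_subset
      (by rw [Finset.sdiff_nonempty]; exact fun h' => hAK (hA.antisymm h')) (by simp [hyA])
    rw [Finset.mem_sdiff] at hb haD
    exact hsep a (by_contra fun h' => haD ⟨ha, h'⟩) b hb.1 hb.2 hab.symm
  · obtain ⟨a, ha, b, hb, hbD, hab⟩ := key A hA hAne hyA
    exact hsep a ha b hb hbD hab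

end Connected

/-! ### Contracting a connected set to the centre of a star -/

section Star

variable {V : Type u}

/-- If `c` is adjacent to the independent set `Y` and each `y ∈ Y` has a private neighbour `t y`,
then local complementations at the vertices of `Y` make `c` adjacent to all these neighbours. -/
theorem exists_adj_of_pendants (c : V) (t : V → V) (Y : Finset V) (G : SimpleGraph V)
    (hc : ∀ y ∈ Y, G.Adj c y) (hY : ∀ y ∈ Y, ∀ z ∈ Y, ¬ G.Adj y z)
    (ht : ∀ y ∈ Y, ∀ z ∈ Y, (G.Adj (t y) z ↔ y = z)) (htc : ∀ y ∈ Y, ¬ G.Adj (t y) c)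
    (hne : ∀ y ∈ Y, t y ≠ c) :
    ∃ G', LocallyEquivalentOn (Y : Set V) G G' ∧ ∀ y ∈ Y, G'.Adj c (t y) := by
  classical
  induction Y using Finset.induction_on generalizing G with
  | empty => exact ⟨G, .refl _ _, by simp⟩
  | insert y₀ Y hy₀ ih =>
    simp only [Finset.mem_insert, forall_eq_or_imp] at hc hY ht htc hne
    have h₁ : ∀ z ∈ Y, ¬ G.Adj y₀ z := hY.1.2
    have h₂ : ∀ y ∈ Y, ¬ G.Adj y₀ (t y) := fun y hy h =>
      hy₀ (((ht.2 y hy).1.1 h.symm) ▸ hy)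
    obtain ⟨G', hG', hadj⟩ := ih (localComplement G y₀)
      (fun y hy => (localComplement_adj_of_not_right (h₁ y hy)).2 (hc.2 y hy))
      (fun y hy z hz => by
        rw [localComplement_adj_of_not_right (h₁ z hz)]; exact (hY.2 y hy).2 z hz)
      (fun y hy z hz => by
        rw [localComplement_adj_of_not_right (h₁ z hz)]; exact (ht.2 y hy).2 z hz)
      (fun y hy => by
        rw [localComplement_adj_of_not_left (h₂ y hy)]; exact htc.2 y hy)
      hne.2
    refine ⟨G', ((LocallyEquivalentOn.single (by simp)).trans (hG'.mono (by simp))), ?_⟩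
    intro y hy
    rcases Finset.mem_insert.1 hy with rfl | hy
    · rw [SimpleGraph.adj_comm, hG'.adj_iff]
      · have htp : G.Adj (t y) y := by simpa using ht.1.1
        exact (localComplement_adj_of_adj hne.1 htp.symm hc.1.symm).2 htc.1
      · intro z hz
        rw [localComplement_adj_of_not_left (h₁ z hz), SimpleGraph.adj_comm, ht.1.2 z hz]
        rintro rfl
        exact hy₀ hz
    · exact hadj y hy

/-- Successive local complementation at `p 0, …, p (k - 1)`. -/
def localComplementSeq (G : SimpleGraph V) (p : ℕ → V) : ℕ → SimpleGraph V
  | 0 => G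
  | k + 1 => localComplement (localComplementSeq G p k) (p k)

theorem localComplementSeq_locallyEquivalentOn {G : SimpleGraph V} {p : ℕ → V} {K : Set V} {k : ℕ}
    (h : ∀ i < k, p i ∈ K) : LocallyEquivalentOn K G (localComplementSeq G p k) := by
  induction k with
  | zero => exact .refl _ _
  | succ k ih =>
    exact (ih fun i hi => h i (by omega)).trans (.single (h k (by omega)))

theorem localComplementSeq_adj_path {G : SimpleGraph V} {p : ℕ → V} {l k : ℕ}
    (hp : ∀ i j, i < j → j ≤ l → (G.Adj (p i) (p j) ↔ i + 1 = j)) {i j : ℕ} (hki : k ≤ i)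
    (hij : i < j) (hj : j ≤ l) :
    (localComplementSeq G p k).Adj (p i) (p j) ↔ i + 1 = j := by
  induction k generalizing i j with
  | zero => exact hp i j hij hj
  | succ k ih =>
    rw [localComplementSeq, localComplement_adj_of_not_right, ih (by omega) hij hj]
    rw [ih le_rfl (by omega) hj]
    omega

theorem localComplementSeq_adj_of_lt {G : SimpleGraph V} {p : ℕ → V} {l k : ℕ}
    (hp : ∀ i j, i < j → j ≤ l → (G.Adj (p i) (p j) ↔ i + 1 = j)) (y : V) {j : ℕ}
    (hkj : k < j) (hj : j ≤ l) :
    (localComplementSeq G p k).Adj (p j) y ↔ G.Adj (p j) y := by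
  induction k with
  | zero => rfl
  | succ k ih =>
    rw [localComplementSeq, localComplement_adj_of_not_left, ih (by omega)]
    rw [localComplementSeq_adj_path hp le_rfl (by omega) hj]
    omega

open Classical in
/-- Local complementation along an induced path accumulates neighbourhoods: afterwards `p k` is
adjacent to exactly those outside vertices that had an odd number of neighbours among
`p 0, …, p k`. -/
theorem localComplementSeq_adj_last {G : SimpleGraph V} {p : ℕ → V} {l k : ℕ}
    (hp : ∀ i j, i < j → j ≤ l → (G.Adj (p i) (p j) ↔ i + 1 = j)) {y : V}
    (hy : ∀ i ≤ l, p i ≠ y) (hk : k ≤ l) :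
    (localComplementSeq G p k).Adj (p k) y ↔
      Odd ((Finset.range (k + 1)).filter fun i => G.Adj (p i) y).card := by
  induction k with
  | zero =>
    by_cases h : G.Adj (p 0) y <;> simp [localComplementSeq, Finset.filter_singleton, h]
  | succ k ih =>
    rw [localComplementSeq, localComplement_adj, ih (by omega),
      localComplementSeq_adj_path hp le_rfl (by omega) hk,
      localComplementSeq_adj_of_lt hp y (by omega) hk, Finset.range_add_one (n := k + 1),
      Finset.filter_insert]
    have hne := hy (k + 1) hk
    by_cases h : G.Adj (p (k + 1)) y
    · rw [if_pos h, Finset.card_insert_of_notMem (by simp)]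
      simp [h, hne, Xor, Nat.odd_add_one]
    · rw [if_neg h]
      simp [h, hne, Xor]

variable [DecidableEq V]

/-- Removing vertices of `K` as long as `K` stays connected and dominates `X`, where a removal may
be preceded by a local complementation at the removed vertex. When no removal is possible, every
remaining `x` has a neighbour in `X` which either has no other neighbour in `K`, or is a true twin
of the cut vertex `x`. -/
theorem exists_reduced (X K : Finset V) (G : SimpleGraph V) (hK : ConnectedOn G K)
    (hKX : Disjoint K X) (hdom : ∀ x ∈ X, ∃ y ∈ K, G.Adj x y) :
    ∃ (G' : SimpleGraph V) (K' : Finset V), LocallyEquivalentOn (K : Set V) G G' ∧ K' ⊆ K ∧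
      ConnectedOn G' K' ∧ (∀ x ∈ X, ∃ y ∈ K', G'.Adj x y) ∧
      ∀ x ∈ K', ∃ t ∈ X, G'.Adj t x ∧ ((∀ y ∈ K', G'.Adj t y → y = x) ∨
        (¬ ConnectedOn G' (K'.erase x) ∧ ∀ y ∈ K', y ≠ x → (G'.Adj t y ↔ G'.Adj x y))) := by
  induction K using Finset.strongInduction generalizing G with
  | _ K ih =>
  by_cases hred : ∀ x ∈ K, ∃ t ∈ X, G.Adj t x ∧ ((∀ y ∈ K, G.Adj t y → y = x) ∨
        (¬ ConnectedOn G (K.erase x) ∧ ∀ y ∈ K, y ≠ x → (G.Adj t y ↔ G.Adj x y)))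
  · exact ⟨G, K, .refl _ _, subset_rfl, hK, hdom, hred⟩
  rw [not_forall] at hred
  simp only [not_forall] at hred
  obtain ⟨x, hx, hred⟩ := hred
  have hsub : ((K.erase x : Finset V) : Set V) ⊆ K := by
    exact_mod_cast Finset.erase_subset x K
  have hdisj : Disjoint (K.erase x) X := hKX.mono_left (Finset.erase_subset _ _)
  by_cases hcon : ConnectedOn G (K.erase x)
  · by_cases hd : ∀ t ∈ X, ∃ y ∈ K.erase x, G.Adj t y
    · obtain ⟨G', K', h₁, h₂, h₃⟩ := ih _ (Finset.erase_ssubset hx) G hcon hdisj hd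
      exact ⟨G', K', h₁.mono hsub, h₂.trans (Finset.erase_subset _ _), h₃⟩
    · push Not at hd
      obtain ⟨t, ht, hty⟩ := hd
      have hpend : ∀ y ∈ K, G.Adj t y → y = x := fun y hy hty' =>
        by_contra fun hyx => hty y (Finset.mem_erase.2 ⟨hyx, hy⟩) hty'
      obtain ⟨y, hy, hty'⟩ := hdom t ht
      exact absurd ⟨t, ht, hpend y hy hty' ▸ hty', Or.inl hpend⟩ hred
  · have hcon' := (hK.erase_or hx).resolve_left hcon
    by_cases hd : ∀ t ∈ X, ∃ y ∈ K.erase x, (localComplement G x).Adj t y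
    · obtain ⟨G', K', h₁, h₂, h₃⟩ := ih _ (Finset.erase_ssubset hx) _ hcon' hdisj hd
      exact ⟨G', K', (LocallyEquivalentOn.single (by exact_mod_cast hx)).trans (h₁.mono hsub),
        h₂.trans (Finset.erase_subset _ _), h₃⟩
    · push Not at hd
      obtain ⟨t, ht, hty⟩ := hd
      have htx : G.Adj t x := by
        by_contra htx
        obtain ⟨y, hy, hty'⟩ := hdom t ht
        refine hty y (Finset.mem_erase.2 ⟨?_, hy⟩)
          ((localComplement_adj_of_not_left fun h => htx h.symm).2 hty')
        rintro rfl
        exact htx hty'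
      refine absurd ⟨t, ht, htx, Or.inr ⟨hcon, fun y hy hyx => ?_⟩⟩ hred
      have := hty y (Finset.mem_erase.2 ⟨hyx, hy⟩)
      have hne : t ≠ y := fun h => Finset.disjoint_left.1 hKX hy (h ▸ ht)
      by_cases hxy : G.Adj x y
      · rw [localComplement_adj_of_adj hne htx.symm hxy, not_not] at this
        exact iff_of_true this hxy
      · rw [localComplement_adj_of_not_right hxy] at this
        exact iff_of_false this hxy

open Classical in
/-- A connected set `K` dominating a huge set `X` can be contracted, by local complementations
inside `K`, to a single vertex that still has many neighbours in `X`. -/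
theorem exists_locallyEquivalentOn_star (N : ℕ) : ∃ F : ℕ, ∀ {V : Type u} (G : SimpleGraph V)
    (K X : Finset V), ConnectedOn G K → Disjoint K X → (∀ x ∈ X, ∃ y ∈ K, G.Adj x y) →
      F ≤ X.card → ∃ G', LocallyEquivalentOn (K : Set V) G G' ∧
        ∃ c ∈ K, N ≤ (X.filter fun x => G'.Adj c x).card := by
  refine ⟨N * (N + 2 ^ (N + N) + 1) ^ (N + 1) + 1, ?_⟩
  intro V G K X hK hKX hdom hF
  by_contra! H
  obtain ⟨G', K', hG', hK'K, hK', hdom', hred⟩ := exists_reduced X K G hK hKX hdom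
  have hK'X : Disjoint K' X := hKX.mono_left hK'K
  have hKs : (K' : Set V) ⊆ K := by exact_mod_cast hK'K
  have hne : ∀ t ∈ X, ∀ y ∈ K', t ≠ y := fun t ht y hy e =>
    Finset.disjoint_left.1 hK'X hy (e ▸ ht)
  -- neither a star nor a set of many neighbours survives, by assumption
  have H' : ∀ G'', LocallyEquivalentOn (K' : Set V) G' G'' → ∀ c ∈ K', ∀ (Y : Finset V) (t : V → V),
      (∀ y ∈ Y, t y ∈ X ∧ G''.Adj c (t y)) → Set.InjOn t Y → Y.card < N := by
    intro G'' hG'' c hc Y t ht hinj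
    refine lt_of_le_of_lt ?_ (H G'' (hG'.trans (hG''.mono hKs)) c (hK'K hc))
    exact Finset.card_le_card_of_injOn t (fun y hy => by simpa using ht y hy) hinj
  choose! t htX htx ht using hred
  have hinj : ∀ Y ⊆ K', (∀ y ∈ Y, ∀ z ∈ K', G'.Adj (t y) z → z = y) → Set.InjOn t Y :=
    fun Y hY hp y hy z hz e => (hp z hz y (hY hy) (e ▸ htx y (hY hy)))
  have hdeg : ∀ c ∈ K', (K'.filter fun y => G'.Adj c y).card ≤ N + 2 ^ (N + N) := by
    intro c hc
    by_contra! hbig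
    set P : V → Prop := fun y => ∀ z ∈ K', G'.Adj (t y) z → z = y
    rw [← Finset.card_filter_add_card_filter_not (s := K'.filter fun y => G'.Adj c y) P] at hbig
    have htwin : ((K'.filter fun y => G'.Adj c y).filter fun y => ¬ P y).card < N := by
      refine H' G' (.refl _ _) c hc _ t ?_ ?_
      · intro y hy
        simp only [Finset.mem_filter] at hy
        obtain ⟨⟨hyK, hcy⟩, hPy⟩ := hy
        exact ⟨htX y hyK, ((((ht y hyK).resolve_left hPy).2 c hc hcy.ne).2 hcy.symm).symm⟩
      · intro y hy z hz e
        simp only [Finset.coe_filter, Finset.mem_filter, Set.mem_ofPred_eq] at hy hz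
        by_contra hyz
        have hy' := (ht y hy.1.1).resolve_left hy.2
        have hz' := (ht z hz.1.1).resolve_left hz.2
        exact hy'.1 (hK'.erase_of_twin hz.1.1 hyz fun w hw hwy hwz => by
          rw [← hy'.2 w hw hwy, ← hz'.2 w hw hwz, e])
    obtain ⟨Y, hYP, hYcard, G₁, hG₁, hG₁c, hYi, hYt⟩ : ∃ Y ⊆ (K'.filter fun y => G'.Adj c y).filter P,
        Y.card = N ∧ ∃ G₁, LocallyEquivalentOn (K' : Set V) G' G₁ ∧ (∀ y, G₁.Adj c y ↔ G'.Adj c y) ∧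
          (∀ y ∈ Y, ∀ z ∈ Y, ¬ G₁.Adj y z) ∧ ∀ y ∈ Y, ∀ z, G₁.Adj (t y) z ↔ G'.Adj (t y) z := by
      rcases exists_clique_or_independent G' (N + N) N N rfl
        ((K'.filter fun y => G'.Adj c y).filter P) (by omega) with
        ⟨Y, hYP, hYc, hY⟩ | ⟨Y, hYP, hYc, hY⟩
      · -- local complementation at `c` turns a clique of neighbours into an independent set
        refine ⟨Y, hYP, hYc, localComplement G' c, .single hc,
          fun y => localComplement_adj_self_left, ?_, ?_⟩
        · intro y hy z hz hyz
          have hcy := (Finset.mem_filter.1 (Finset.mem_filter.1 (hYP hy)).1).2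
          have hcz := (Finset.mem_filter.1 (Finset.mem_filter.1 (hYP hz)).1).2
          exact (localComplement_adj_of_adj hyz.ne hcy hcz).1 hyz (hY y hy z hz hyz.ne)
        · intro y hy z
          have hy' := Finset.mem_filter.1 (hYP hy)
          refine localComplement_adj_of_not_left fun h => ?_
          exact (Finset.mem_filter.1 hy'.1).2.ne (hy'.2 c hc h.symm)
      · exact ⟨Y, hYP, hYc, G', .refl _ _, fun _ => Iff.rfl, hY, fun _ _ _ => Iff.rfl⟩
    have hYmem : ∀ y ∈ Y, y ∈ K' ∧ G'.Adj c y ∧ P y := by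
      intro y hy
      have := hYP hy
      simp only [Finset.mem_filter] at this
      exact ⟨this.1.1, this.1.2, this.2⟩
    have hYK : Y ⊆ K' := fun y hy => (hYmem y hy).1
    obtain ⟨G₂, hG₂, hG₂c⟩ := exists_adj_of_pendants c t Y G₁
      (fun y hy => (hG₁c y).2 (hYmem y hy).2.1) hYi
      (fun y hy z hz => by
        rw [hYt y hy]
        exact ⟨fun h => ((hYmem y hy).2.2 z (hYK hz) h).symm, fun h => h ▸ htx y (hYK hy)⟩)
      (fun y hy => by
        rw [hYt y hy]
        exact fun h => (hYmem y hy).2.1.ne ((hYmem y hy).2.2 c hc h))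
      (fun y hy => hne _ (htX y (hYK hy)) c hc)
    exact absurd hYcard (H' G₂ (hG₁.trans (hG₂.mono (by exact_mod_cast hYK))) c hc Y t
      (fun y hy => ⟨htX y (hYK hy), hG₂c y hy⟩) (hinj Y hYK fun y hy => (hYmem y hy).2.2)).ne
  have hXK : X.card ≤ K'.card * N := by
    have hsub : X ⊆ K'.biUnion fun y => X.filter fun x => G'.Adj y x := by
      intro x hx
      obtain ⟨y, hy, hxy⟩ := hdom' x hx
      exact Finset.mem_biUnion.2 ⟨y, hy, Finset.mem_filter.2 ⟨hx, hxy.symm⟩⟩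
    exact (Finset.card_le_card hsub).trans
      (Finset.card_biUnion_le_card_mul _ _ _ fun y hy => (H G' hG' y (hK'K hy)).le)
  have hcard : (N + 2 ^ (N + N) + 1) ^ (N + 1) < K'.card := by
    by_contra! hle
    have := hXK.trans (Nat.mul_le_mul_right N hle)
    rw [mul_comm] at this
    omega
  obtain ⟨r, hr⟩ : K'.Nonempty := Finset.card_pos.1 (by omega)
  have hconn := hK'.connected_induce ⟨r, hr⟩
  obtain ⟨x, hx⟩ := exists_dist_gt (G := G'.induce (K' : Set V)) hconn (d := N + 2 ^ (N + N))
    (l := N + 1) ⟨r, hr⟩ (fun y => by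
      refine le_trans (le_of_eq ?_) (hdeg y y.2)
      refine Finset.card_bij (fun z _ => (z : V)) ?_ ?_ ?_
      · intro z hz
        simpa using hz
      · intro z _ w _ e
        exact Subtype.ext e
      · intro z hz
        rw [Finset.mem_filter] at hz
        exact ⟨⟨z, hz.1⟩, by simpa using hz.2, rfl⟩) (by simpa using hcard)
  obtain ⟨p, -, -, hp⟩ := exists_induced_path (hconn ⟨r, hr⟩ x)
  set l := (G'.induce (K' : Set V)).dist ⟨r, hr⟩ x
  set p' : ℕ → V := fun i => p i with hp'
  have hpK : ∀ i, p' i ∈ K' := fun i => (p i).2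
  have hadj : ∀ i j, i < j → j ≤ l → (G'.Adj (p' i) (p' j) ↔ i + 1 = j) :=
    fun i j hij hj => (hp i j hij hj).2
  have hpne : ∀ i j, i < j → j ≤ l → p' i ≠ p' j :=
    fun i j hij hj e => (hp i j hij hj).1 (Subtype.ext e)
  have hpinj : ∀ i j, i ≤ l → j ≤ l → p' i = p' j → i = j := by
    intro i j hi hj e
    rcases lt_trichotomy i j with h | h | h
    · exact absurd e (hpne i j h hj)
    · exact h
    · exact absurd e.symm (hpne j i h hi)
  have hadj' : ∀ i j, i ≤ l → j ≤ l → (G'.Adj (p' i) (p' j) ↔ i + 1 = j ∨ j + 1 = i) := by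
    intro i j hi hj
    rcases lt_trichotomy i j with h | rfl | h
    · rw [hadj i j h hj]; omega
    · simp
    · rw [G'.adj_comm, hadj j i h hi]; omega
  -- the neighbours on the path of the vertex of `X` attached to an inner path vertex
  have htp : ∀ i, 1 ≤ i → i < l → (∀ j ≤ l, G'.Adj (p' j) (t (p' i)) ↔ j = i) ∨
      (∀ j ≤ l, G'.Adj (p' j) (t (p' i)) ↔ j + 1 = i ∨ j = i ∨ j = i + 1) := by
    intro i hi hil
    rcases ht (p' i) (hpK i) with h | ⟨-, h⟩
    · refine Or.inl fun j hj => ⟨fun hj' => hpinj j i hj (by omega) (h _ (hpK j) hj'.symm), ?_⟩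
      rintro rfl
      exact (htx _ (hpK _)).symm
    · refine Or.inr fun j hj => ?_
      by_cases hji : j = i
      · subst hji
        simpa using (htx _ (hpK _)).symm
      · rw [G'.adj_comm, h _ (hpK j) fun e => hji (hpinj j i hj (by omega) e),
          hadj' i j (by omega) hj]
        omega
  have := H' (localComplementSeq G' p' l)
    (localComplementSeq_locallyEquivalentOn fun i _ => hpK i) (p' l) (hpK l)
    ((Finset.Icc 1 N).image p') t ?_ ?_
  · rw [Finset.card_image_of_injOn] at this
    · simp at this
    · intro i hi j hj e
      simp only [Finset.coe_Icc, Set.mem_Icc] at hi hj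
      exact hpinj i j (by omega) (by omega) e
  · intro y hy
    simp only [Finset.mem_image, Finset.mem_Icc] at hy
    obtain ⟨i, hi, rfl⟩ := hy
    refine ⟨htX _ (hpK i), (localComplementSeq_adj_last hadj
      (fun j _ => (hne _ (htX _ (hpK i)) _ (hpK j)).symm) le_rfl).2 ?_⟩
    rcases htp i hi.1 (by omega) with h | h
    · have : (Finset.range (l + 1)).filter (fun j => G'.Adj (p' j) (t (p' i))) = {i} := by
        ext j
        simp only [Finset.mem_filter, Finset.mem_range, Finset.mem_singleton]
        constructor
        · rintro ⟨hj, hj'⟩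
          exact (h j (by omega)).1 hj'
        · rintro rfl
          exact ⟨by omega, (h _ (by omega)).2 rfl⟩
      rw [this, Finset.card_singleton]
      exact odd_one
    · have : (Finset.range (l + 1)).filter (fun j => G'.Adj (p' j) (t (p' i))) =
          Finset.Icc (i - 1) (i + 1) := by
        ext j
        simp only [Finset.mem_filter, Finset.mem_range, Finset.mem_Icc]
        constructor
        · rintro ⟨hj, hj'⟩
          have := (h j (by omega)).1 hj'
          omega
        · intro hj
          exact ⟨by omega, (h _ (by omega)).2 (by omega)⟩
      rw [this, Nat.card_Icc, show i + 1 + 1 - (i - 1) = 3 by omega]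
      decide
  · intro y hy z hz e
    simp only [Finset.coe_image, Finset.coe_Icc, Set.mem_image, Set.mem_Icc] at hy hz
    obtain ⟨i, hi, rfl⟩ := hy
    obtain ⟨j, hj, rfl⟩ := hz
    suffices i = j by rw [this]
    rcases htp i hi.1 (by omega) with h | h <;> rcases htp j hj.1 (by omega) with h' | h' <;>
      rw [e] at h
    · exact (h' i (by omega)).1 ((h i (by omega)).2 rfl)
    · have h₁ := (h (j + 1) (by omega)).1 ((h' (j + 1) (by omega)).2 (by omega))
      have h₂ := (h j (by omega)).1 ((h' j (by omega)).2 (by omega))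
      omega
    · have h₁ := (h' (i + 1) (by omega)).1 ((h (i + 1) (by omega)).2 (by omega))
      have h₂ := (h' i (by omega)).1 ((h i (by omega)).2 (by omega))
      omega
    · have h₁ := (h' (i + 1) (by omega)).1 ((h (i + 1) (by omega)).2 (by omega))
      have h₂ := (h (j + 1) (by omega)).1 ((h' (j + 1) (by omega)).2 (by omega))
      omega

end Star

/-! ### A contracted set matched to the patch -/

section Matching

variable {V : Type u} {G : SimpleGraph V}

/-- Pivoting on the edge `x s`, away from `x` and `s`. -/
theorem pivot_adj {x s a b : V} (hxs : G.Adj x s) (hax : a ≠ x) (has : a ≠ s) (hbx : b ≠ x)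
    (hbs : b ≠ s) (hab : a ≠ b) :
    (localComplement (localComplement (localComplement G x) s) x).Adj a b ↔
      Xor (G.Adj a b) (Xor (G.Adj x a ∧ G.Adj s b) (G.Adj s a ∧ G.Adj x b)) := by
  have hsx := hxs.symm
  have hne := hxs.ne
  simp only [localComplement_adj, ne_eq, hab, hax.symm, hbx.symm, has.symm, hbs.symm,
    hne.symm, hxs, hsx, not_false_eq_true, true_and, SimpleGraph.irrefl]
  by_cases h₁ : G.Adj a b <;> by_cases h₂ : G.Adj x a <;> by_cases h₃ : G.Adj x b <;>
    by_cases h₄ : G.Adj s a <;> by_cases h₅ : G.Adj s b <;> simp [Xor, h₁, h₂, h₃, h₄, h₅]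

/-- Suppose `c` is joined to a set `Q` by internally disjoint paths `c, x i, s i, b i` without
further edges, except that `s i` may have more neighbours in `Q`, none of which is `b j` with
`i < j`. Pivoting on the edge `x i s i` adds the neighbourhood of `s i` in `Q` to that of `c`.
Proceeding from large to small indices and pivoting only where needed makes `c` adjacent to all
`b i`, without changing `Q`. -/
theorem exists_adj_of_pivots {ι : Type*} [LinearOrder ι] (Q : Set V) (c : V) (x s b : ι → V)
    (I : Finset ι) (hcQ : c ∉ Q) (hxQ : ∀ i ∈ I, x i ∉ Q) (hsQ : ∀ i ∈ I, s i ∉ Q)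
    (hsc : ∀ i ∈ I, s i ≠ c) (hbQ : ∀ i ∈ I, b i ∈ Q)
    (hxc : ∀ i ∈ I, G.Adj c (x i)) (hsc' : ∀ i ∈ I, ¬ G.Adj c (s i))
    (hxs : ∀ i ∈ I, ∀ j ∈ I, (G.Adj (x i) (s j) ↔ i = j))
    (hxx : ∀ i ∈ I, ∀ j ∈ I, ¬ G.Adj (x i) (x j)) (hss : ∀ i ∈ I, ∀ j ∈ I, ¬ G.Adj (s i) (s j))
    (hxQ' : ∀ i ∈ I, ∀ y ∈ Q, ¬ G.Adj (x i) y)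
    (hsb : ∀ i ∈ I, G.Adj (s i) (b i)) (hsb' : ∀ i ∈ I, ∀ j ∈ I, i < j → ¬ G.Adj (s i) (b j)) :
    ∃ G', LocallyEquivalentOn (x '' I ∪ s '' I) G G' ∧
      (∀ y ∈ Q, ∀ z ∈ Q, (G'.Adj y z ↔ G.Adj y z)) ∧ ∀ i ∈ I, G'.Adj c (b i) := by
  induction I using Finset.induction_on_min with
  | empty => exact ⟨G, .refl _ _, fun _ _ _ _ => Iff.rfl, by simp⟩
  | insert a I ha ih =>
    have haI : a ∉ I := fun h => lt_irrefl _ (ha a h)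
    simp only [Finset.mem_insert, forall_eq_or_imp] at hxQ hsQ hsc hbQ hxc hsc' hxs hxx hss hxQ'
    simp only [Finset.mem_insert, forall_eq_or_imp] at hsb hsb'
    obtain ⟨G', hG', hQ, hcb⟩ := ih hxQ.2 hsQ.2 hsc.2 hbQ.2 hxc.2 hsc'.2
      (fun i hi => (hxs.2 i hi).2) (fun i hi => (hxx.2 i hi).2) (fun i hi => (hss.2 i hi).2)
      hxQ'.2 hsb.2 (fun i hi => (hsb'.2 i hi).2)
    have hmono : x '' (I : Set ι) ∪ s '' I ⊆ x '' (insert a I : Finset ι) ∪ s '' (insert a I : Finset ι) := by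
      gcongr <;> simp
    by_cases hca : G'.Adj c (b a)
    · refine ⟨G', hG'.mono hmono, hQ, fun i hi => ?_⟩
      rcases Finset.mem_insert.1 hi with rfl | hi
      · exact hca
      · exact hcb i hi
    have hxa : ∀ y, G'.Adj (x a) y ↔ G.Adj (x a) y := by
      refine hG'.adj_iff ?_
      rintro _ (⟨i, hi, rfl⟩ | ⟨i, hi, rfl⟩)
      · exact (hxx.2 i hi).1
      · rw [SimpleGraph.adj_comm, hxs.1.2 i hi]
        rintro rfl
        exact haI hi
    have hsa : ∀ y, G'.Adj (s a) y ↔ G.Adj (s a) y := by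
      refine hG'.adj_iff ?_
      rintro _ (⟨i, hi, rfl⟩ | ⟨i, hi, rfl⟩)
      · rw [(hxs.2 i hi).1]
        rintro rfl
        exact haI hi
      · exact (hss.2 i hi).1
    have hadj : G'.Adj (x a) (s a) := by simpa [hxa] using hxs.1.1
    have hQx : ∀ y ∈ Q, y ≠ x a := fun y hy e => hxQ.1 (e ▸ hy)
    have hQs : ∀ y ∈ Q, y ≠ s a := fun y hy e => hsQ.1 (e ▸ hy)
    have hxaG : G.Adj (x a) c := hxc.1.symm
    have hsaG : ¬ G.Adj (s a) c := fun h => hsc'.1 h.symm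
    have hpiv : ∀ y ∈ Q, (localComplement (localComplement (localComplement G' (x a)) (s a))
        (x a)).Adj c y ↔ Xor (G'.Adj c y) (G.Adj (s a) y) := by
      intro y hy
      rw [pivot_adj hadj hxc.1.ne hsc.1.symm (hQx y hy) (hQs y hy) (fun e => hcQ (e ▸ hy)),
        hxa, hsa, hsa, hxa]
      simp [hxaG, hsaG, Xor]
    refine ⟨localComplement (localComplement (localComplement G' (x a)) (s a)) (x a),
      (hG'.mono hmono).trans (((LocallyEquivalentOn.single ?_).trans (.single ?_)).trans
        (.single ?_)), ?_, ?_⟩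
    · exact Or.inl ⟨a, by simp, rfl⟩
    · exact Or.inr ⟨a, by simp, rfl⟩
    · exact Or.inl ⟨a, by simp, rfl⟩
    · intro y hy z hz
      by_cases hyz : y = z
      · subst hyz; simp
      rw [pivot_adj hadj (hQx y hy) (hQs y hy) (hQx z hz) (hQs z hz) hyz, hxa, hsa, hsa, hxa,
        hQ y hy z hz]
      simp [hxQ'.1 y hy, hxQ'.1 z hz, Xor]
    · intro i hi
      rcases Finset.mem_insert.1 hi with rfl | hi
      · rw [hpiv _ hbQ.1]
        exact Or.inr ⟨hsb.1, hca⟩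
      · rw [hpiv _ (hbQ.2 i hi)]
        exact Or.inl ⟨hcb i hi, hsb'.1.2 i hi (ha i hi)⟩

open Classical in
/-- The wheel in the case where the patch is matched into a set dominated by a connected set `K`
away from the cycle and the patch: contract `K` to one vertex and pivot on the matching. -/
theorem exists_hasVertexMinor_of_matching {n : ℕ} (hn : 3 ≤ n) : ∃ F : ℕ, ∀ {V : Type u}
    (G : SimpleGraph V) {M m : ℕ} (q : ℕ → V) (x s : Fin M → V) (b : Fin M → ℕ) (I : Finset (Fin M))
    (K : Finset V), IsInducedCycle G m q → ConnectedOn G K →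
      (∀ i ∈ I, b i < m) → Set.InjOn b I →
      (∀ i ∈ I, G.Adj (s i) (q (b i))) → (∀ i ∈ I, ∀ j ∈ I, i < j → ¬ G.Adj (s i) (q (b j))) →
      (∀ i ∈ I, ∀ j ∈ I, ¬ G.Adj (s i) (s j)) →
      (∀ i ∈ I, ∀ j ∈ I, (G.Adj (x i) (s j) ↔ i = j)) →
      (∀ i ∈ I, ∀ j < m, ¬ G.Adj (x i) (q j)) → (∀ i ∈ I, ∀ j < m, x i ≠ q j) →
      (∀ i ∈ I, ∀ j < m, s i ≠ q j) →
      (∀ y ∈ K, ∀ j < m, ¬ G.Adj y (q j)) → (∀ y ∈ K, ∀ j < m, y ≠ q j) →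
      (∀ y ∈ K, ∀ i ∈ I, ¬ G.Adj y (s i)) → (∀ y ∈ K, ∀ i ∈ I, y ≠ s i) →
      (∀ y ∈ K, ∀ i ∈ I, y ≠ x i) → (∀ i ∈ I, ∃ y ∈ K, G.Adj (x i) y) →
      F ≤ I.card → HasVertexMinor G (wheelGraph n) := by
  obtain ⟨F, hF⟩ := exists_locallyEquivalentOn_star.{u} (2 ^ ((n + 6) + (n + 6)))
  refine ⟨F, ?_⟩
  intro V G M m q x s b I K hq hK hbm hbinj hsb hsb' hss hxs hxq hxq' hsq hKq hKq' hKs hKs' hKx hdom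
    hFI
  have hxinj : Set.InjOn x I := by
    intro i hi j hj e
    have := (hxs i hi i hi).2 rfl
    rw [e] at this
    exact ((hxs j hj i hi).1 this).symm
  obtain ⟨G₁, hG₁, c, hcK, hcN⟩ := hF G K (I.image x) hK (by
      rw [Finset.disjoint_left]
      intro y hy hyI
      obtain ⟨i, hi, rfl⟩ := Finset.mem_image.1 hyI
      exact hKx _ hy i hi rfl) (by
      intro y hy
      obtain ⟨i, hi, rfl⟩ := Finset.mem_image.1 hy
      exact hdom i hi) (by rwa [Finset.card_image_of_injOn hxinj])
  obtain ⟨t, htI, htc, G₂, hG₂, hct, htt⟩ : ∃ t ⊆ I.image x, t.card = n + 6 ∧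
      ∃ G₂, LocallyEquivalentOn (K : Set V) G G₂ ∧ (∀ y ∈ t, G₂.Adj c y) ∧
        ∀ y ∈ t, ∀ z ∈ t, ¬ G₂.Adj y z := by
    rcases exists_clique_or_independent G₁ ((n + 6) + (n + 6)) (n + 6) (n + 6) rfl _ hcN with
      ⟨t, ht, htc, hclq⟩ | ⟨t, ht, htc, hind⟩
    · refine ⟨t, ht.trans (Finset.filter_subset _ _), htc, localComplement G₁ c,
        hG₁.trans (.single hcK), ?_, ?_⟩
      · intro y hy
        exact localComplement_adj_self_left.2 (Finset.mem_filter.1 (ht hy)).2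
      · intro y hy z hz hyz
        exact (localComplement_adj_of_adj hyz.ne (Finset.mem_filter.1 (ht hy)).2
          (Finset.mem_filter.1 (ht hz)).2).1 hyz (hclq y hy z hz hyz.ne)
    · exact ⟨t, ht.trans (Finset.filter_subset _ _), htc, G₁, hG₁,
        fun y hy => (Finset.mem_filter.1 (ht hy)).2, hind⟩
  have hqadj : ∀ j < m, ∀ y, G₂.Adj (q j) y ↔ G.Adj (q j) y := fun j hj =>
    hG₂.adj_iff fun y hy => hKq y hy j hj
  have hsadj : ∀ i ∈ I, ∀ y, G₂.Adj (s i) y ↔ G.Adj (s i) y := fun i hi =>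
    hG₂.adj_iff fun y hy => hKs y hy i hi
  set J := I.filter fun i => x i ∈ t with hJ
  have hJI : ∀ i ∈ J, i ∈ I := fun i hi => (Finset.mem_filter.1 hi).1
  have hJcard : n + 6 ≤ J.card := by
    rw [← htc]
    have : t ⊆ J.image x := by
      intro y hy
      obtain ⟨i, hi, rfl⟩ := Finset.mem_image.1 (htI hy)
      exact Finset.mem_image_of_mem _ (Finset.mem_filter.2 ⟨hi, hy⟩)
    exact (Finset.card_le_card this).trans Finset.card_image_le
  obtain ⟨G₃, hG₃, hQ, hcb⟩ := exists_adj_of_pivots (G := G₂) {y | ∃ j < m, y = q j} c x s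
    (fun i => q (b i)) J
    (fun ⟨j, hj, e⟩ => hKq' c hcK j hj e)
    (fun i hi ⟨j, hj, e⟩ => hxq' i (hJI i hi) j hj e)
    (fun i hi ⟨j, hj, e⟩ => hsq i (hJI i hi) j hj e)
    (fun i hi e => hKs' c hcK i (hJI i hi) e.symm)
    (fun i hi => ⟨b i, hbm i (hJI i hi), rfl⟩)
    (fun i hi => hct _ (Finset.mem_filter.1 hi).2)
    (fun i hi => by
      rw [SimpleGraph.adj_comm, hsadj i (hJI i hi), SimpleGraph.adj_comm]
      exact hKs c hcK i (hJI i hi))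
    (fun i hi j hj => by
      rw [SimpleGraph.adj_comm, hsadj j (hJI j hj), SimpleGraph.adj_comm]
      exact hxs i (hJI i hi) j (hJI j hj))
    (fun i hi j hj => htt _ (Finset.mem_filter.1 hi).2 _ (Finset.mem_filter.1 hj).2)
    (fun i hi j hj => by rw [hsadj i (hJI i hi)]; exact hss i (hJI i hi) j (hJI j hj))
    (fun i hi y ⟨j, hj, e⟩ => by
      rw [e, SimpleGraph.adj_comm, hqadj j hj, SimpleGraph.adj_comm]
      exact hxq i (hJI i hi) j hj)
    (fun i hi => by rw [hsadj i (hJI i hi)]; exact hsb i (hJI i hi))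
    (fun i hi j hj hij => by
      rw [hsadj i (hJI i hi)]; exact hsb' i (hJI i hi) j (hJI j hj) hij)
  refine HasVertexMinor.of_locallyEquivalent (hG₂.locallyEquivalent) (HasVertexMinor.of_locallyEquivalent
    hG₃.locallyEquivalent (hasVertexMinor_wheelGraph hn (m := m) (c := q) (h := c) ?_
      (fun i hi => hKq' c hcK i hi) (Or.inr (Or.inr (Or.inr ?_)))))
  · refine ⟨hq.three_le, hq.inj, fun {i j} hi hj => ?_⟩
    rw [hQ _ ⟨i, hi, rfl⟩ _ ⟨j, hj, rfl⟩, hqadj i hi, hq.adj hi hj]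
  · refine hJcard.trans (Finset.card_le_card_of_injOn b ?_ (hbinj.mono fun i hi => hJI i hi))
    intro i hi
    simp only [Finset.coe_filter, Finset.mem_range, Set.mem_ofPred_eq]
    exact ⟨hbm i (hJI i hi), hcb i hi⟩

end Matching

/-! ### Separating finite sets of positions on a line -/

section Intervals

/-- Among many intervals there are `n` pairwise disjoint ones or `C` with a common point. -/
theorem exists_disjoint_or_common {ι : Type*} (C : ℕ) (l r : ι → ℕ) (hlr : ∀ i, l i ≤ r i) (n : ℕ)
    (J : Finset ι) (hJ : n * C ≤ J.card) :
    (∃ J' ⊆ J, n ≤ J'.card ∧ ∀ i ∈ J', ∀ j ∈ J', i ≠ j → r i < l j ∨ r j < l i) ∨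
      ∃ p, ∃ J' ⊆ J, C ≤ J'.card ∧ ∀ i ∈ J', l i ≤ p ∧ p ≤ r i := by
  classical
  induction n generalizing J with
  | zero => exact Or.inl ⟨∅, by simp, by simp, by simp⟩
  | succ n ih =>
    rcases J.eq_empty_or_nonempty with rfl | hne
    · refine Or.inr ⟨0, ∅, by simp, ?_, by simp⟩
      rw [Nat.succ_mul, Finset.card_empty] at hJ
      rw [Finset.card_empty]
      omega
    -- an interval with leftmost right end: those meeting it contain that right end
    obtain ⟨j₀, hj₀, hmin⟩ := Finset.exists_min_image J r hne
    by_cases hA : C ≤ (J.filter fun j => l j ≤ r j₀).card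
    · exact Or.inr ⟨r j₀, _, Finset.filter_subset _ _, hA, fun i hi =>
        ⟨(Finset.mem_filter.1 hi).2, hmin i (Finset.mem_filter.1 hi).1⟩⟩
    have hsplit := Finset.card_filter_add_card_filter_not (s := J) fun j => l j ≤ r j₀
    rw [Nat.succ_mul] at hJ
    have hsub : (J.filter fun j => ¬ l j ≤ r j₀) ⊆ J := Finset.filter_subset _ _
    rcases ih (J.filter fun j => ¬ l j ≤ r j₀) (by omega) with
      ⟨J', hJ', hc, hd⟩ | ⟨p, J', hJ', hc, hd⟩
    · have hlt : ∀ j ∈ J', r j₀ < l j := fun j hj => not_le.1 (Finset.mem_filter.1 (hJ' hj)).2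
      have hj₀' : j₀ ∉ J' := fun h => absurd (hlt j₀ h) (not_lt.2 (hlr j₀))
      refine Or.inl ⟨insert j₀ J', ?_, ?_, ?_⟩
      · exact Finset.insert_subset hj₀ (hJ'.trans hsub)
      · rw [Finset.card_insert_of_notMem hj₀']; omega
      · intro i hi j hj hij
        rcases Finset.mem_insert.1 hi with hi' | hi' <;> rcases Finset.mem_insert.1 hj with hj' | hj'
        · exact absurd (hi'.trans hj'.symm) hij
        · exact Or.inl (hi' ▸ hlt j hj')
        · exact Or.inr (hj' ▸ hlt i hi')
        · exact hd i hi' j hj' hij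
    · exact Or.inr ⟨p, J', hJ'.trans hsub, hc, hd⟩

/-- Many finite sets `N j` of bounded size with distinct marked points `b j ∈ N j` become
separated from each other after passing to a window `[lo, hi)` and to many of the sets whose marked
points lie in the window. If many of the convex hulls have a common point `p`, then restricting to
the side of `p` that contains the marked point decreases the sizes. -/
theorem exists_separated (d n : ℕ) : ∃ F : ℕ, ∀ {ι : Type} (J : Finset ι) (N : ι → Finset ℕ)
    (b : ι → ℕ), Set.InjOn b J → (∀ j ∈ J, b j ∈ N j ∧ (N j).card ≤ d) → F ≤ J.card →
      ∃ lo hi : ℕ, ∃ J' ⊆ J, n ≤ J'.card ∧ (∀ j ∈ J', lo ≤ b j ∧ b j < hi) ∧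
        ∀ i ∈ J', ∀ j ∈ J', b i < b j → ∀ x ∈ N i, ∀ y ∈ N j,
          lo ≤ x → x < hi → lo ≤ y → y < hi → x < y := by
  classical
  induction d with
  | zero =>
    refine ⟨1, fun J N b _ hN hJ => ?_⟩
    obtain ⟨j, hj⟩ := Finset.card_pos.1 hJ
    obtain ⟨h₁, h₂⟩ := hN j hj
    rw [Nat.le_zero, Finset.card_eq_zero] at h₂
    simp [h₂] at h₁
  | succ d ih =>
    obtain ⟨F, hF⟩ := ih
    refine ⟨n * (2 * F + 1), fun {ι} J N b hb hN hJ => ?_⟩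
    -- the hulls, extended to indices outside `J` by the marked point
    set l : ι → ℕ := fun j => (insert (b j) (N j)).min' ⟨_, Finset.mem_insert_self _ _⟩
    set r : ι → ℕ := fun j => (insert (b j) (N j)).max' ⟨_, Finset.mem_insert_self _ _⟩
    have hl : ∀ j, ∀ x ∈ insert (b j) (N j), l j ≤ x := fun j x hx => Finset.min'_le _ _ hx
    have hr : ∀ j, ∀ x ∈ insert (b j) (N j), x ≤ r j := fun j x hx => Finset.le_max' _ _ hx
    have hlN : ∀ j ∈ J, l j ∈ N j := fun j hj => by
      rcases Finset.mem_insert.1 (Finset.min'_mem (insert (b j) (N j))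
        ⟨_, Finset.mem_insert_self _ _⟩) with h | h
      · exact (show l j = b j from h) ▸ (hN j hj).1
      · exact h
    have hrN : ∀ j ∈ J, r j ∈ N j := fun j hj => by
      rcases Finset.mem_insert.1 (Finset.max'_mem (insert (b j) (N j))
        ⟨_, Finset.mem_insert_self _ _⟩) with h | h
      · exact (show r j = b j from h) ▸ (hN j hj).1
      · exact h
    have hlb : ∀ j, l j ≤ b j := fun j => hl j _ (Finset.mem_insert_self _ _)
    have hbr : ∀ j, b j ≤ r j := fun j => hr j _ (Finset.mem_insert_self _ _)
    rcases exists_disjoint_or_common (2 * F + 1) l r (fun j => (hlb j).trans (hbr j)) n J hJ with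
      ⟨J', hJ', hc, hd⟩ | ⟨p, J', hJ', hc, hp⟩
    · refine ⟨0, J'.sup b + 1, J', hJ', hc,
        fun j hj => ⟨Nat.zero_le _, Nat.lt_succ_of_le (Finset.le_sup hj)⟩, ?_⟩
      intro i hi j hj hij x hx y hy _ _ _ _
      have h₁ := hr i x (Finset.mem_insert_of_mem hx)
      have h₂ := hl j y (Finset.mem_insert_of_mem hy)
      have := hlb i
      have := hbr j
      rcases hd i hi j hj (fun e => by simp [e] at hij) with h | h <;> omega
    · have hsplit := Finset.card_filter_add_card_filter_not (s := J') fun j => b j < p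
      by_cases hlt : F ≤ (J'.filter fun j => b j < p).card
      · obtain ⟨lo, hi, J'', hJ'', hc'', hb'', hsep⟩ := hF (J'.filter fun j => b j < p)
          (fun j => (N j).filter fun x => x < p) b
          (hb.mono fun j hj => hJ' (Finset.mem_filter.1 hj).1) (fun j hj => by
            have hj' := Finset.mem_filter.1 hj
            have hjJ := hJ' hj'.1
            refine ⟨Finset.mem_filter.2 ⟨(hN j hjJ).1, hj'.2⟩, ?_⟩
            have hsub : ((N j).filter fun x => x < p) ⊆ (N j).erase (r j) := by
              intro x hx
              have hx' := Finset.mem_filter.1 hx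
              have := (hp j hj'.1).2
              exact Finset.mem_erase.2 ⟨by omega, hx'.1⟩
            have := Finset.card_le_card hsub
            rw [Finset.card_erase_of_mem (hrN j hjJ)] at this
            have := (hN j hjJ).2
            omega) hlt
        have hJp : ∀ j ∈ J'', b j < p := fun j hj => (Finset.mem_filter.1 (hJ'' hj)).2
        refine ⟨lo, min hi p, J'', hJ''.trans ((Finset.filter_subset _ _).trans hJ'), hc'',
          fun j hj => ⟨(hb'' j hj).1, lt_min (hb'' j hj).2 (hJp j hj)⟩, ?_⟩
        intro i hi' j hj hij x hx y hy h₁ h₂ h₃ h₄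
        exact hsep i hi' j hj hij x (Finset.mem_filter.2 ⟨hx, by omega⟩) y
          (Finset.mem_filter.2 ⟨hy, by omega⟩) h₁ (by omega) h₃ (by omega)
      · have hgt : F ≤ (J'.filter fun j => p < b j).card := by
          have hle : (J'.filter fun j => ¬ b j < p).card ≤ (J'.filter fun j => p < b j).card + 1 := by
            have hone : (J'.filter fun j => b j = p).card ≤ 1 := by
              refine Finset.card_le_one.2 fun i hi j hj => ?_
              rw [Finset.mem_filter] at hi hj
              exact hb (hJ' hi.1) (hJ' hj.1) (hi.2.trans hj.2.symm)
            have hsub : (J'.filter fun j => ¬ b j < p) ⊆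
                (J'.filter fun j => p < b j) ∪ J'.filter fun j => b j = p := by
              intro j hj
              rw [Finset.mem_filter] at hj
              rw [Finset.mem_union, Finset.mem_filter, Finset.mem_filter]
              rcases lt_or_eq_of_le (not_lt.1 hj.2) with h | h
              · exact Or.inl ⟨hj.1, h⟩
              · exact Or.inr ⟨hj.1, h.symm⟩
            have := (Finset.card_le_card hsub).trans (Finset.card_union_le _ _)
            omega
          omega
        obtain ⟨lo, hi, J'', hJ'', hc'', hb'', hsep⟩ := hF (J'.filter fun j => p < b j)
          (fun j => (N j).filter fun x => p < x) b
          (hb.mono fun j hj => hJ' (Finset.mem_filter.1 hj).1) (fun j hj => by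
            have hj' := Finset.mem_filter.1 hj
            have hjJ := hJ' hj'.1
            refine ⟨Finset.mem_filter.2 ⟨(hN j hjJ).1, hj'.2⟩, ?_⟩
            have hsub : ((N j).filter fun x => p < x) ⊆ (N j).erase (l j) := by
              intro x hx
              have hx' := Finset.mem_filter.1 hx
              have := (hp j hj'.1).1
              exact Finset.mem_erase.2 ⟨by omega, hx'.1⟩
            have := Finset.card_le_card hsub
            rw [Finset.card_erase_of_mem (hlN j hjJ)] at this
            have := (hN j hjJ).2
            omega) hgt
        have hJp : ∀ j ∈ J'', p < b j := fun j hj => (Finset.mem_filter.1 (hJ'' hj)).2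
        refine ⟨max lo (p + 1), hi, J'', hJ''.trans ((Finset.filter_subset _ _).trans hJ'), hc'',
          fun j hj => ⟨max_le (hb'' j hj).1 (hJp j hj), (hb'' j hj).2⟩, ?_⟩
        intro i hi' j hj hij x hx y hy h₁ h₂ h₃ h₄
        exact hsep i hi' j hj hij x (Finset.mem_filter.2 ⟨hx, by omega⟩) y
          (Finset.mem_filter.2 ⟨hy, by omega⟩) (by omega) h₂ (by omega) h₄

end Intervals

/-! ### Legs between a hub and a cycle -/

section Legs

theorem card_add_one_le_of_injOn {S S' : Finset ℕ} (f : ℕ → ℕ) (x : ℕ) (hf : Set.InjOn f S)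
    (hx : x ∈ S') (h : ∀ i ∈ S, f i ∈ S' ∧ f i ≠ x) : S.card + 1 ≤ S'.card := by
  have hx' : x ∉ S.image f := by
    intro hx'
    obtain ⟨i, hi, e⟩ := Finset.mem_image.1 hx'
    exact (h i hi).2 e
  rw [← Finset.card_image_of_injOn hf, ← Finset.card_insert_of_notMem hx']
  refine Finset.card_le_card (Finset.insert_subset hx fun y hy => ?_)
  obtain ⟨i, hi, rfl⟩ := Finset.mem_image.1 hy
  exact (h i hi).1

variable {V : Type u}

open Classical in
/-- Let `t` be joined to `L` pairwise non-adjacent vertices `s j` whose neighbours on the cycle lie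
in pairwise disjoint segments `[α j, β j]` in front of position `B`. Each leg `s j`, taken from the
last to the first, can be used to add one spoke at `t`: if `β j ≥ α j + 2`, the cycle is rerouted
through `s j`; if `β j = α j + 1`, local complementation at `s j` subdivides the edge of the cycle
between its two neighbours by `s j`; and if `β j = α j`, local complementation at `s j` makes `t`
adjacent to the only neighbour of `s j` on the cycle. -/
theorem exists_hub_of_legs (t : V) (L : ℕ) (G : SimpleGraph V) (m : ℕ) (c : ℕ → V) (B k : ℕ)
    (s : ℕ → V) (α β : ℕ → ℕ) (hc : IsInducedCycle G m c) (hB : B < m) (htc : ∀ i < m, t ≠ c i)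
    (htB : ∀ i < B, ¬ G.Adj t (c i))
    (hk : k ≤ ((Finset.Ico B m).filter fun i => G.Adj t (c i)).card)
    (hts : ∀ j < L, G.Adj t (s j)) (hsc : ∀ j < L, ∀ i < m, s j ≠ c i)
    (hαβ : ∀ j < L, α j ≤ β j) (hβB : ∀ j < L, β j < B)
    (hsα : ∀ j < L, G.Adj (s j) (c (α j))) (hsβ : ∀ j < L, G.Adj (s j) (c (β j)))
    (hseg : ∀ j < L, ∀ i < m, G.Adj (s j) (c i) → α j ≤ i ∧ i ≤ β j)
    (hβα : ∀ i j, i < j → j < L → β i < α j) (hss : ∀ i < L, ∀ j < L, ¬ G.Adj (s i) (s j)) :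
    ∃ (G' : SimpleGraph V) (m' : ℕ) (c' : ℕ → V), LocallyEquivalent G G' ∧
      IsInducedCycle G' m' c' ∧ (∀ i < m', t ≠ c' i) ∧ k + L ≤ hubDegree G' t m' c' := by
  induction L generalizing G m c B k with
  | zero =>
    refine ⟨G, m, c, Relation.ReflTransGen.refl, hc, htc, hk.trans (Finset.card_le_card ?_)⟩
    refine Finset.filter_subset_filter _ fun i hi => ?_
    simp at hi ⊢
    exact hi.2
  | succ L ih =>
    have hL : L < L + 1 := Nat.lt_succ_self L
    set a := α L with ha
    set e := β L with he
    have hae := hαβ L hL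
    have heB := hβB L hL
    have hsL := hsc L hL
    have hsegL := hseg L hL
    have hnL : ∀ i < m, (i < a ∨ e < i) → ¬ G.Adj (s L) (c i) := by
      intro i hi h h'
      have := hsegL i hi h'
      omega
    have htL := hts L hL
    have hne : ∀ j < L, s j ≠ s L := by
      intro j hj h
      have h₁ := hsegL (β j) (by have := hβB j (by omega); omega) (h ▸ hsβ j (by omega))
      have h₂ := hβα j L hj hL
      omega
    have hLs : ∀ j < L, ¬ G.Adj (s L) (s j) := fun j hj => hss L hL j (by omega)
    have htsL : t ≠ s L := htL.ne
    by_cases hcase : a + 2 ≤ e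
    · -- reroute the cycle through `s L`
      set c' : ℕ → V := fun i => if i ≤ a then c i else if i = a + 1 then s L else c (i + (e - a - 2))
        with hc'
      have c'_le : ∀ {i}, i ≤ a → c' i = c i := fun hi => by simp [hc', hi]
      have c'_eq : c' (a + 1) = s L := by simp [hc']
      have c'_gt : ∀ {i}, a + 1 < i → c' i = c (i + (e - a - 2)) := fun {i} hi => by
        simp [hc', show ¬ i ≤ a by omega, show i ≠ a + 1 by omega]
      have hsLc : ∀ i < m, (i ≤ a ∨ e ≤ i) → (G.Adj (s L) (c i) ↔ i = a ∨ i = e) := by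
        intro i hi hie
        refine ⟨fun h => ?_, ?_⟩
        · have := hsegL i hi h
          omega
        · rintro (rfl | rfl)
          · exact hsα L hL
          · exact hsβ L hL
      have key := ih G (m - (e - a - 2)) c' a (k + 1) ?_ (by omega) ?_ ?_ ?_
        (fun j hj => hts j (by omega)) ?_ (fun j hj => hαβ j (by omega)) (fun j hj => hβα j L hj hL)
        ?_ ?_ ?_ (fun i j hij hj => hβα i j hij (by omega))
        (fun i hi j hj => hss i (by omega) j (by omega))
      · obtain ⟨G', m', c'', h₁, h₂, h₃, h₄⟩ := key
        exact ⟨G', m', c'', h₁, h₂, h₃, by omega⟩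
      · refine .of_lt (by omega) ?_ ?_
        · intro i j hij hj
          rcases lt_trichotomy j (a + 1) with h | rfl | h
          · rw [c'_le (by omega), c'_le (by omega), Ne, hc.inj (by omega) (by omega)]; omega
          · rw [c'_le (by omega), c'_eq]; exact (hsL _ (by omega)).symm
          · rw [c'_gt h]
            rcases lt_trichotomy i (a + 1) with h' | rfl | h'
            · rw [c'_le (by omega), Ne, hc.inj (by omega) (by omega)]; omega
            · rw [c'_eq]; exact hsL _ (by omega)
            · rw [c'_gt h', Ne, hc.inj (by omega) (by omega)]; omega
        · intro i j hij hj
          rcases lt_trichotomy j (a + 1) with h | rfl | h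
          · rw [c'_le (by omega), c'_le (by omega), hc.adj (by omega) (by omega)]; omega
          · rw [c'_le (by omega), c'_eq, G.adj_comm, hsLc _ (by omega) (by omega)]; omega
          · rw [c'_gt h]
            rcases lt_trichotomy i (a + 1) with h' | rfl | h'
            · rw [c'_le (by omega), hc.adj (by omega) (by omega)]; omega
            · rw [c'_eq, hsLc _ (by omega) (by omega)]; omega
            · rw [c'_gt h', hc.adj (by omega) (by omega)]; omega
      · intro i hi
        rcases lt_trichotomy i (a + 1) with h | rfl | h
        · rw [c'_le (by omega)]; exact htc _ (by omega)
        · rw [c'_eq]; exact htsL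
        · rw [c'_gt h]; exact htc _ (by omega)
      · intro i hi
        rw [c'_le (by omega)]
        exact htB i (by omega)
      · refine (Nat.succ_le_succ hk).trans (card_add_one_le_of_injOn (fun i => i - (e - a - 2)) (a + 1)
          ?_ ?_ ?_)
        · intro i hi j hj hij
          simp only [Finset.coe_filter, Finset.mem_Ico, Set.mem_ofPred_eq] at hi hj hij
          omega
        · simp only [Finset.mem_filter, Finset.mem_Ico, c'_eq]
          exact ⟨by omega, htL⟩
        · intro i hi
          simp only [Finset.mem_filter, Finset.mem_Ico] at hi ⊢
          refine ⟨⟨by omega, ?_⟩, by omega⟩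
          rw [c'_gt (by omega), Nat.sub_add_cancel (by omega)]
          exact hi.2
      · intro j hj i hi
        rcases lt_trichotomy i (a + 1) with h | rfl | h
        · rw [c'_le (by omega)]; exact hsc j (by omega) _ (by omega)
        · rw [c'_eq]; exact hne j hj
        · rw [c'_gt h]; exact hsc j (by omega) _ (by omega)
      · intro j hj
        have := hβα j L hj hL
        have := hαβ j (by omega)
        rw [c'_le (by omega)]
        exact hsα j (by omega)
      · intro j hj
        have := hβα j L hj hL
        rw [c'_le (by omega)]
        exact hsβ j (by omega)
      · intro j hj i hi hadj
        have := hβα j L hj hL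
        rcases lt_trichotomy i (a + 1) with h | rfl | h
        · rw [c'_le (by omega)] at hadj; exact hseg j (by omega) _ (by omega) hadj
        · rw [c'_eq] at hadj; exact absurd hadj.symm (hLs j hj)
        · rw [c'_gt h] at hadj
          have := hseg j (by omega) _ (by omega) hadj
          omega
    · have hs₁ : ∀ j < L, ∀ y, (localComplement G (s L)).Adj (s j) y ↔ G.Adj (s j) y :=
        fun j hj y => localComplement_adj_of_not_left (hLs j hj)
      have hts₁ : ∀ j < L, (localComplement G (s L)).Adj t (s j) := fun j hj =>
        (localComplement_adj_of_not_right (hLs j hj)).2 (hts j (by omega))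
      have htc₁ : ∀ i < m, (i < a ∨ e < i) →
          ((localComplement G (s L)).Adj t (c i) ↔ G.Adj t (c i)) := fun i hi h =>
        localComplement_adj_of_not_right (hnL i hi h)
      have hss₁ : ∀ i < L, ∀ j < L, ¬ (localComplement G (s L)).Adj (s i) (s j) := by
        intro i hi j hj
        rw [hs₁ i hi]
        exact hss i (by omega) j (by omega)
      by_cases hcase' : e = a
      · -- `s L` has a single neighbour on the cycle, which becomes adjacent to `t`
        have hcc : ∀ i < m, ∀ j < m, ((localComplement G (s L)).Adj (c i) (c j) ↔
            G.Adj (c i) (c j)) := by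
          intro i hi j hj
          by_cases h : G.Adj (s L) (c i)
          · by_cases h' : G.Adj (s L) (c j)
            · have h₁ := hsegL i hi h
              have h₂ := hsegL j hj h'
              obtain rfl : i = j := by omega
              simp
            · exact localComplement_adj_of_not_right h'
          · exact localComplement_adj_of_not_left h
        have key := ih (localComplement G (s L)) m c a (k + 1)
          ⟨hc.three_le, hc.inj, fun hi hj => by rw [hcc _ hi _ hj, hc.adj hi hj]⟩ (by omega) htc
          (fun i hi => by rw [htc₁ i (by omega) (by omega)]; exact htB i (by omega)) ?_ hts₁
          (fun j hj => hsc j (by omega)) (fun j hj => hαβ j (by omega)) (fun j hj => hβα j L hj hL)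
          (fun j hj => (hs₁ j hj _).2 (hsα j (by omega)))
          (fun j hj => (hs₁ j hj _).2 (hsβ j (by omega)))
          (fun j hj i hi h => hseg j (by omega) i hi ((hs₁ j hj _).1 h))
          (fun i j hij hj => hβα i j hij (by omega)) hss₁
        · obtain ⟨G', m', c'', h₁, h₂, h₃, h₄⟩ := key
          exact ⟨G', m', c'', Relation.ReflTransGen.head ⟨_, rfl⟩ h₁, h₂, h₃, by omega⟩
        · refine (Nat.succ_le_succ hk).trans (card_add_one_le_of_injOn id a ?_ ?_ ?_)
          · exact Set.injOn_id _
          · simp only [Finset.mem_filter, Finset.mem_Ico]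
            refine ⟨by omega, ?_⟩
            exact (localComplement_adj_of_adj (htc a (by omega)) htL.symm (hsα L hL)).2
              (htB a (by omega))
          · intro i hi
            simp only [Finset.mem_filter, Finset.mem_Ico, id] at hi ⊢
            exact ⟨⟨by omega, (htc₁ i (by omega) (by omega)).2 hi.2⟩, by omega⟩
      · -- `s L` subdivides an edge of the cycle
        have hea : e = a + 1 := by omega
        set c' : ℕ → V := fun i => if i ≤ a then c i else if i = a + 1 then s L else c (i - 1)
          with hc'
        have c'_le : ∀ {i}, i ≤ a → c' i = c i := fun hi => by simp [hc', hi]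
        have c'_eq : c' (a + 1) = s L := by simp [hc']
        have c'_gt : ∀ {i}, a + 1 < i → c' i = c (i - 1) := fun {i} hi => by
          simp [hc', show ¬ i ≤ a by omega, show i ≠ a + 1 by omega]
        have hsLc : ∀ i < m, ((localComplement G (s L)).Adj (s L) (c i) ↔ i = a ∨ i = a + 1) := by
          intro i hi
          rw [localComplement_adj_self_left]
          refine ⟨fun h => ?_, ?_⟩
          · have := hsegL i hi h
            omega
          · rintro (rfl | rfl)
            · exact hsα L hL
            · exact hea ▸ hsβ L hL
        have hcc : ∀ i j, i < j → j < m → ((localComplement G (s L)).Adj (c i) (c j) ↔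
            G.Adj (c i) (c j) ∧ ¬ (i = a ∧ j = a + 1)) := by
          intro i j hij hj
          by_cases h : i = a ∧ j = a + 1
          · obtain ⟨rfl, rfl⟩ := h
            rw [localComplement_adj_of_adj (by rw [Ne, hc.inj (by omega) hj]; omega) (hsα L hL)
              (hea ▸ hsβ L hL), hc.adj (by omega) hj]
            omega
          · simp only [h, not_false_eq_true, and_true]
            by_cases h' : G.Adj (s L) (c i)
            · refine localComplement_adj_of_not_right fun h'' => h ?_
              have h₁ := hsegL i (by omega) h'
              have h₂ := hsegL j hj h''
              omega
            · exact localComplement_adj_of_not_left h'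
        have key := ih (localComplement G (s L)) (m + 1) c' a (k + 1) ?_ (by omega) ?_ ?_ ?_ hts₁
          ?_ (fun j hj => hαβ j (by omega)) (fun j hj => hβα j L hj hL)
          ?_ ?_ ?_ (fun i j hij hj => hβα i j hij (by omega)) hss₁
        · obtain ⟨G', m', c'', h₁, h₂, h₃, h₄⟩ := key
          exact ⟨G', m', c'', Relation.ReflTransGen.head ⟨_, rfl⟩ h₁, h₂, h₃, by omega⟩
        · have hm := hc.three_le
          refine .of_lt (by omega) ?_ ?_
          · intro i j hij hj
            rcases lt_trichotomy j (a + 1) with h | rfl | h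
            · rw [c'_le (by omega), c'_le (by omega), Ne, hc.inj (by omega) (by omega)]; omega
            · rw [c'_le (by omega), c'_eq]; exact (hsL _ (by omega)).symm
            · rw [c'_gt h]
              rcases lt_trichotomy i (a + 1) with h' | rfl | h'
              · rw [c'_le (by omega), Ne, hc.inj (by omega) (by omega)]; omega
              · rw [c'_eq]; exact hsL _ (by omega)
              · rw [c'_gt h', Ne, hc.inj (by omega) (by omega)]; omega
          · intro i j hij hj
            rcases lt_trichotomy j (a + 1) with h | rfl | h
            · rw [c'_le (by omega), c'_le (by omega), hcc _ _ hij (by omega),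
                hc.adj (by omega) (by omega)]
              omega
            · rw [c'_le (by omega), c'_eq, SimpleGraph.adj_comm, hsLc _ (by omega)]; omega
            · rw [c'_gt h]
              rcases lt_trichotomy i (a + 1) with h' | rfl | h'
              · rw [c'_le (by omega), hcc _ _ (by omega) (by omega), hc.adj (by omega) (by omega)]
                omega
              · rw [c'_eq, hsLc _ (by omega)]; omega
              · rw [c'_gt h', hcc _ _ (by omega) (by omega), hc.adj (by omega) (by omega)]
                omega
        · intro i hi
          rcases lt_trichotomy i (a + 1) with h | rfl | h
          · rw [c'_le (by omega)]; exact htc _ (by omega)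
          · rw [c'_eq]; exact htsL
          · rw [c'_gt h]; exact htc _ (by omega)
        · intro i hi
          rw [c'_le (by omega), htc₁ i (by omega) (by omega)]
          exact htB i (by omega)
        · refine (Nat.succ_le_succ hk).trans (card_add_one_le_of_injOn (fun i => i + 1) (a + 1)
            ?_ ?_ ?_)
          · intro i _ j _ hij
            simpa using hij
          · simp only [Finset.mem_filter, Finset.mem_Ico, c'_eq]
            exact ⟨by omega, (localComplement_adj_self_left.2 htL.symm).symm⟩
          · intro i hi
            simp only [Finset.mem_filter, Finset.mem_Ico] at hi ⊢
            refine ⟨⟨by omega, ?_⟩, by omega⟩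
            rw [c'_gt (by omega), Nat.add_sub_cancel, htc₁ i (by omega) (by omega)]
            exact hi.2
        · intro j hj i hi
          rcases lt_trichotomy i (a + 1) with h | rfl | h
          · rw [c'_le (by omega)]; exact hsc j (by omega) _ (by omega)
          · rw [c'_eq]; exact hne j hj
          · rw [c'_gt h]; exact hsc j (by omega) _ (by omega)
        · intro j hj
          have := hβα j L hj hL
          have := hαβ j (by omega)
          rw [c'_le (by omega), hs₁ j hj]
          exact hsα j (by omega)
        · intro j hj
          have := hβα j L hj hL
          rw [c'_le (by omega), hs₁ j hj]
          exact hsβ j (by omega)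
        · intro j hj i hi hadj
          have := hβα j L hj hL
          rw [hs₁ j hj] at hadj
          rcases lt_trichotomy i (a + 1) with h | rfl | h
          · rw [c'_le (by omega)] at hadj; exact hseg j (by omega) _ (by omega) hadj
          · rw [c'_eq] at hadj; exact absurd hadj.symm (hLs j hj)
          · rw [c'_gt h] at hadj
            have := hseg j (by omega) _ (by omega) hadj
            omega

end Legs

/-! ### A single vertex adjacent to a large part of the patch -/

section Hub

variable {V : Type u} {G : SimpleGraph V}

/-- An increasing enumeration of the marked points of a finite set of indices. -/
theorem exists_enumeration {ι : Type*} (J : Finset ι) (b : ι → ℕ) (hb : Set.InjOn b J) (k : ℕ)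
    (hk : k + 1 ≤ J.card) : ∃ g : ℕ → ι, (∀ r, g r ∈ J) ∧ ∀ r r', r < r' → r' ≤ k →
      b (g r) < b (g r') := by
  classical
  have hcard : (J.image b).card = J.card := Finset.card_image_of_injOn hb
  let e := (J.image b).orderEmbOfFin hcard
  have he : ∀ r, ∃ i ∈ J, b i = e r := fun r =>
    Finset.mem_image.1 ((J.image b).orderEmbOfFin_mem hcard r)
  choose g hg hbg using he
  refine ⟨fun r => if h : r < J.card then g ⟨r, h⟩ else g ⟨0, by omega⟩, ?_, ?_⟩
  · intro r
    dsimp only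
    split_ifs
    · exact hg _
    · exact hg _
  · intro r r' hr hr'
    dsimp only
    rw [dif_pos (by omega), dif_pos (by omega), hbg, hbg]
    exact e.strictMono (by simpa using hr)

/-- Closing a segment `q lo, …, q hi` of the cycle by an induced path `p` from a vertex adjacent to
the last vertex only to a vertex adjacent to the first vertex only. -/
theorem IsInducedCycle.close {m : ℕ} {q : ℕ → V} (hq : IsInducedCycle G m q) {lo hi l : ℕ}
    {p : ℕ → V} (hlo : lo < hi) (hhi : hi + 1 < m) (hl : 2 ≤ l)
    (hp : ∀ i j, i < j → j ≤ l → p i ≠ p j ∧ (G.Adj (p i) (p j) ↔ i + 1 = j))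
    (hpq : ∀ i ≤ l, ∀ j < m, p i ≠ q j)
    (hp₀ : ∀ j, lo ≤ j → j ≤ hi → (G.Adj (q j) (p 0) ↔ j = hi))
    (hpl : ∀ j, lo ≤ j → j ≤ hi → (G.Adj (q j) (p l) ↔ j = lo))
    (hin : ∀ i, 0 < i → i < l → ∀ j < m, ¬ G.Adj (q j) (p i)) :
    IsInducedCycle G (hi - lo + l + 2)
      (fun i => if i ≤ hi - lo then q (lo + i) else p (i - (hi - lo) - 1)) := by
  refine .of_lt (by omega) ?_ ?_
  · intro i j hij hj
    split_ifs with h₁ h₂ h₂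
    · rw [Ne, hq.inj (by omega) (by omega)]; omega
    · exact (hpq _ (by omega) _ (by omega)).symm
    · omega
    · exact (hp _ _ (by omega) (by omega)).1
  · intro i j hij hj
    split_ifs with h₁ h₂ h₂
    · rw [hq.adj (by omega) (by omega)]; omega
    · by_cases h0 : j - (hi - lo) - 1 = 0
      · rw [h0, hp₀ _ (by omega) (by omega)]; omega
      · by_cases hjl : j - (hi - lo) - 1 = l
        · rw [hjl, hpl _ (by omega) (by omega)]; omega
        · have := hin (j - (hi - lo) - 1) (by omega) (by omega) (lo + i) (by omega)
          simp only [this, false_iff]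
          omega
    · omega
    · rw [(hp _ _ (by omega) (by omega)).2]; omega

open Classical in
/-- The wheel in the case where a vertex `t` is adjacent to many vertices of the first patch. If no
vertex of the patches has many neighbours on the cycle, then in a suitable segment of the cycle the
neighbourhoods of the patches are separated; the segment is closed to a cycle through `s₂ a`, the
connected set `T` and `s₂ z` for the first and last indices `a`, `z`, and the vertices `s₁ j`
between are the legs of the hub `t`. -/
theorem exists_hasVertexMinor_of_hub {n : ℕ} (hn : 3 ≤ n) : ∃ F : ℕ, ∀ {V : Type u}
    (G : SimpleGraph V) {M m : ℕ} (q : ℕ → V) (s₁ s₂ : Fin M → V) (b : Fin M → ℕ)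
    (J : Finset (Fin M)) (t : V) (T : Set V), IsInducedCycle G m q →
      (∀ i, b i < m) → Function.Injective b →
      (∀ i, G.Adj (s₁ i) (q (b i))) → (∀ i, G.Adj (s₂ i) (q (b i))) →
      (∀ i j, ¬ G.Adj (s₁ i) (s₁ j)) → (∀ i j, ¬ G.Adj (s₁ i) (s₂ j)) →
      (∀ i j, ¬ G.Adj (s₂ i) (s₂ j)) →
      (∀ i, ∀ j < m, s₁ i ≠ q j) → (∀ i, ∀ j < m, s₂ i ≠ q j) → (∀ i j, s₁ i ≠ s₂ j) →
      Function.Injective s₂ →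
      (∀ i ∈ J, G.Adj t (s₁ i)) → (∀ j < m, ¬ G.Adj t (q j)) → (∀ j < m, t ≠ q j) →
      (∀ j, t ≠ s₂ j) → t ∉ T →
      (∀ y ∈ T, ∀ j < m, ¬ G.Adj (q j) y) → (∀ y ∈ T, ∀ j < m, y ≠ q j) →
      (∀ y ∈ T, ∀ j, ¬ G.Adj (s₁ j) y) → (∀ y ∈ T, ∀ j, s₁ j ≠ y) →
      (∀ i j, ∃ w : G.Walk (s₂ i) (s₂ j), ∀ y ∈ w.support, y ∈ T ∨ y = s₂ i ∨ y = s₂ j) →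
      F ≤ J.card → HasVertexMinor G (wheelGraph n) := by
  obtain ⟨F, hF⟩ := exists_separated (2 * (n + 6)) (n + 8)
  refine ⟨F + 1, ?_⟩
  intro V G M m q s₁ s₂ b J t T hq hbm hb hs₁b hs₂b hs₁₁ hs₁₂ hs₂₂ hs₁q hs₂q hs₁s₂ hs₂inj hts₁ htq
    htq' hts₂ htT hTq hTq' hTs₁ hTs₁' hwalk hJ
  by_cases hbig : ∃ v : V, (∀ j < m, v ≠ q j) ∧ n + 6 ≤ hubDegree G v m q
  · obtain ⟨v, hv, hvd⟩ := hbig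
    exact hasVertexMinor_wheelGraph hn hq hv (Or.inr (Or.inr (Or.inr hvd)))
  push Not at hbig
  -- omitting the last position `m - 1` ensures that segments of the cycle are induced paths
  set N : Fin M → Finset ℕ := fun i =>
    (Finset.range (m - 1)).filter fun x => G.Adj (s₁ i) (q x) ∨ G.Adj (s₂ i) (q x) with hN
  have hNmem : ∀ i x, x ∈ N i ↔ x < m - 1 ∧ (G.Adj (s₁ i) (q x) ∨ G.Adj (s₂ i) (q x)) := by
    intro i x
    simp [hN]
  have hNcard : ∀ i, (N i).card ≤ 2 * (n + 6) := by
    intro i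
    have hsub : N i ⊆ ((Finset.range m).filter fun x => G.Adj (s₁ i) (q x)) ∪
        ((Finset.range m).filter fun x => G.Adj (s₂ i) (q x)) := by
      intro x hx
      rw [hNmem] at hx
      simp only [Finset.mem_union, Finset.mem_filter, Finset.mem_range]
      rcases hx.2 with h | h
      · exact Or.inl ⟨by omega, h⟩
      · exact Or.inr ⟨by omega, h⟩
    have h₁ : _ < n + 6 := hbig (s₁ i) (hs₁q i)
    have h₂ : _ < n + 6 := hbig (s₂ i) (hs₂q i)
    have := (Finset.card_le_card hsub).trans (Finset.card_union_le _ _)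
    unfold hubDegree at h₁ h₂
    omega
  have hm3 := hq.three_le
  have hJ₀ : F ≤ (J.filter fun i => b i < m - 1).card := by
    have hsplit := Finset.card_filter_add_card_filter_not (s := J) fun i => b i < m - 1
    have hone : (J.filter fun i => ¬ b i < m - 1).card ≤ 1 := by
      refine Finset.card_le_one.2 fun i hi j hj => ?_
      rw [Finset.mem_filter] at hi hj
      have := hbm i
      have := hbm j
      exact hb (by omega)
    omega
  obtain ⟨lo, hi, J', hJ', hJ'c, hJ'b, hsep⟩ := hF (J.filter fun i => b i < m - 1) N b hb.injOn
    (fun j hj => ⟨(hNmem _ _).2 ⟨(Finset.mem_filter.1 hj).2, Or.inl (hs₁b j)⟩, hNcard j⟩) hJ₀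
  obtain ⟨g, hgJ, hgb⟩ := exists_enumeration J' b hb.injOn (n + 7) (by omega)
  have hgm : ∀ r, b (g r) < m - 1 := fun r => (Finset.mem_filter.1 (hJ' (hgJ r))).2
  have hgt : ∀ r, G.Adj t (s₁ (g r)) := fun r => hts₁ _ (Finset.mem_filter.1 (hJ' (hgJ r))).1
  have hsep' : ∀ r r', r < r' → r' ≤ n + 7 → ∀ x ∈ N (g r), ∀ y ∈ N (g r'),
      lo ≤ x → x < hi → lo ≤ y → y < hi → x < y := fun r r' hr hr' =>
    hsep _ (hgJ r) _ (hgJ r') (hgb r r' hr hr')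
  -- the last neighbour of the first vertex and the first neighbour of the last vertex
  obtain ⟨pa, hpa, hpamax⟩ := Finset.exists_max_image
    ((Finset.Ico lo hi).filter fun x => x < m - 1 ∧ G.Adj (s₂ (g 0)) (q x)) id
    ⟨b (g 0), by
      simp only [Finset.mem_filter, Finset.mem_Ico]
      exact ⟨hJ'b _ (hgJ 0), hgm 0, hs₂b _⟩⟩
  obtain ⟨pz, hpz, hpzmin⟩ := Finset.exists_min_image
    ((Finset.Ico lo hi).filter fun x => x < m - 1 ∧ G.Adj (s₂ (g (n + 7))) (q x)) id
    ⟨b (g (n + 7)), by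
      simp only [Finset.mem_filter, Finset.mem_Ico]
      exact ⟨hJ'b _ (hgJ _), hgm _, hs₂b _⟩⟩
  simp only [Finset.mem_filter, Finset.mem_Ico, id, and_imp] at hpa hpz hpamax hpzmin
  have hpaN : pa ∈ N (g 0) := (hNmem _ _).2 ⟨hpa.2.1, Or.inr hpa.2.2⟩
  have hpzN : pz ∈ N (g (n + 7)) := (hNmem _ _).2 ⟨hpz.2.1, Or.inr hpz.2.2⟩
  have hpapz : pa < pz := hsep' 0 (n + 7) (by omega) le_rfl pa hpaN pz hpzN hpa.1.1 hpa.1.2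
    hpz.1.1 hpz.1.2
  -- the closing path
  obtain ⟨w, hw⟩ := hwalk (g (n + 7)) (g 0)
  have hreach : (G.induce {y | y ∈ T ∨ y = s₂ (g (n + 7)) ∨ y = s₂ (g 0)}).Reachable
      ⟨s₂ (g (n + 7)), Or.inr (Or.inl rfl)⟩ ⟨s₂ (g 0), Or.inr (Or.inr rfl)⟩ :=
    (w.induce _ hw).reachable
  obtain ⟨p, hp0, hpl, hp⟩ := exists_induced_path hreach
  set l := (G.induce {y | y ∈ T ∨ y = s₂ (g (n + 7)) ∨ y = s₂ (g 0)}).dist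
      ⟨s₂ (g (n + 7)), Or.inr (Or.inl rfl)⟩ ⟨s₂ (g 0), Or.inr (Or.inr rfl)⟩
  have hp0' : (p 0 : V) = s₂ (g (n + 7)) := by rw [hp0]
  have hpl' : (p l : V) = s₂ (g 0) := by rw [hpl]
  have hgne : s₂ (g (n + 7)) ≠ s₂ (g 0) := by
    intro h
    have := hgb 0 (n + 7) (by omega) le_rfl
    rw [hs₂inj h] at this
    omega
  have hl2 : 2 ≤ l := by
    by_contra! hl
    interval_cases hl' : l
    · exact hgne (hp0'.symm.trans hpl')
    · have := ((hp 0 1 (by omega) (by omega)).2).2 rfl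
      have : G.Adj (p 0 : V) (p 1 : V) := this
      rw [hp0', hpl'] at this
      exact hs₂₂ _ _ this
  have hpne : ∀ i j, i < j → j ≤ l → (p i : V) ≠ p j := fun i j hij hj e =>
    (hp i j hij hj).1 (Subtype.ext e)
  have hpT : ∀ i, 0 < i → i < l → (p i : V) ∈ T := by
    intro i hi hil
    rcases (p i).2 with h | h | h
    · exact h
    · exact absurd (hp0'.trans h.symm) (hpne 0 i hi (by omega))
    · exact absurd (h.trans hpl'.symm) (hpne i l hil le_rfl)
  have hpcases : ∀ i ≤ l, (p i : V) ∈ T ∨ ∃ j, (p i : V) = s₂ j := by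
    intro i _
    rcases (p i).2 with h | h | h
    · exact Or.inl h
    · exact Or.inr ⟨_, h⟩
    · exact Or.inr ⟨_, h⟩
  have hcyc := hq.close (lo := pa) (hi := pz) (l := l) (p := fun i => (p i : V)) hpapz (by omega) hl2
    (fun i j hij hj => ⟨hpne i j hij hj, (hp i j hij hj).2⟩)
    (fun i hi j hj => by
      rcases hpcases i hi with h | ⟨k, h⟩
      · exact hTq' _ h j hj
      · rw [h]; exact hs₂q k j hj)
    (fun j hj hj' => by
      rw [hp0', G.adj_comm]
      refine ⟨fun h => le_antisymm hj' (hpzmin j (by omega) (by omega) (by omega) h), ?_⟩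
      rintro rfl
      exact hpz.2.2)
    (fun j hj hj' => by
      rw [hpl', G.adj_comm]
      refine ⟨fun h => le_antisymm (hpamax j (by omega) (by omega) (by omega) h) hj, ?_⟩
      rintro rfl
      exact hpa.2.2)
    (fun i hi hil j hj => hTq _ (hpT i hi hil) j hj)
  set c : ℕ → V := fun i => if i ≤ pz - pa then q (pa + i) else p (i - (pz - pa) - 1) with hc
  have c_le : ∀ {i}, i ≤ pz - pa → c i = q (pa + i) := fun h => by simp [hc, h]
  have c_gt : ∀ {i}, pz - pa < i → c i = p (i - (pz - pa) - 1) := fun h => by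
    simp [hc, not_le.2 h]
  have htc : ∀ i < pz - pa + l + 2, t ≠ c i := by
    intro i hi
    rcases le_or_gt i (pz - pa) with h | h
    · rw [c_le h]; exact htq' _ (by omega)
    · rw [c_gt h]
      rcases hpcases (i - (pz - pa) - 1) (by omega) with h' | ⟨k, h'⟩
      · exact fun e => htT (e ▸ h')
      · rw [h']; exact hts₂ k
  -- positions of the neighbours of the legs
  have hlegN : ∀ r, ∀ i ≤ pz - pa, G.Adj (s₁ (g r)) (c i) → pa + i ∈ N (g r) := by
    intro r i hi h
    rw [c_le hi] at h
    exact (hNmem _ _).2 ⟨by omega, Or.inl h⟩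
  have hlegc : ∀ r, ∀ i < pz - pa + l + 2, G.Adj (s₁ (g r)) (c i) → i ≤ pz - pa := by
    intro r i hi h
    by_contra! hgt'
    rw [c_gt hgt'] at h
    rcases hpcases (i - (pz - pa) - 1) (by omega) with h' | ⟨k, h'⟩
    · exact hTs₁ _ h' _ h
    · rw [h'] at h; exact hs₁₂ _ _ h
  have hleg : ∀ j, j < n + 6 → ∃ x y, x ≤ y ∧ y < pz - pa ∧ G.Adj (s₁ (g (j + 1))) (c x) ∧
      G.Adj (s₁ (g (j + 1))) (c y) ∧ ∀ i < pz - pa + l + 2, G.Adj (s₁ (g (j + 1))) (c i) →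
        x ≤ i ∧ i ≤ y := by
    intro j hj
    have hne : ((Finset.range (pz - pa + 1)).filter fun i =>
        G.Adj (s₁ (g (j + 1))) (c i)).Nonempty := by
      have hbN : b (g (j + 1)) ∈ N (g (j + 1)) := (hNmem _ _).2 ⟨hgm _, Or.inl (hs₁b _)⟩
      have hbw := hJ'b _ (hgJ (j + 1))
      have h₁ := hsep' 0 (j + 1) (by omega) (by omega) pa hpaN _ hbN hpa.1.1 hpa.1.2 hbw.1 hbw.2
      have h₂ := hsep' (j + 1) (n + 7) (by omega) le_rfl _ hbN pz hpzN hbw.1 hbw.2 hpz.1.1 hpz.1.2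
      refine ⟨b (g (j + 1)) - pa, ?_⟩
      simp only [Finset.mem_filter, Finset.mem_range]
      refine ⟨by omega, ?_⟩
      rw [c_le (by omega), Nat.add_sub_cancel' h₁.le]
      exact hs₁b _
    obtain ⟨x, hx, hxmin⟩ := Finset.exists_min_image _ id hne
    obtain ⟨y, hy, hymax⟩ := Finset.exists_max_image _ id hne
    have hxy : x ≤ y := hxmin y hy
    simp only [Finset.mem_filter, Finset.mem_range, id, and_imp] at hx hy hxmin hymax
    have hyz := hsep' (j + 1) (n + 7) (by omega) le_rfl _ (hlegN _ y (by omega) hy.2) pz hpzN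
      (by omega) (by omega) hpz.1.1 hpz.1.2
    refine ⟨x, y, hxy, by omega, hx.2, hy.2, fun i hi h => ?_⟩
    have := hlegc _ i hi h
    exact ⟨hxmin i (by omega) h, hymax i (by omega) h⟩
  choose! α β hαβ hβ hadjα hadjβ hseg using hleg
  obtain ⟨G', m', c', hG', hc', htc', hdeg⟩ := exists_hub_of_legs t (n + 6) G (pz - pa + l + 2) c
    (pz - pa) 0 (fun j => s₁ (g (j + 1))) α β hcyc (by omega) htc
    (fun i hi => by rw [c_le hi.le]; exact htq _ (by omega)) (Nat.zero_le _)
    (fun j _ => hgt _)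
    (fun j _ i hi => by
      rcases le_or_gt i (pz - pa) with h | h
      · rw [c_le h]; exact hs₁q _ _ (by omega)
      · rw [c_gt h]
        rcases hpcases (i - (pz - pa) - 1) (by omega) with h' | ⟨k, h'⟩
        · exact hTs₁' _ h' _
        · rw [h']; exact hs₁s₂ _ k)
    hαβ hβ hadjα hadjβ hseg
    (fun i j hij hj => by
      have h₁ := hβ i (by omega)
      have h₂ := hβ j hj
      have h₃ := hαβ j hj
      have := hsep' (i + 1) (j + 1) (by omega) (by omega)
        _ (hlegN _ _ (by omega) (hadjβ i (by omega))) _ (hlegN _ _ (by omega) (hadjα j hj))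
        (by omega) (by omega) (by omega) (by omega)
      omega)
    (fun i _ j _ => hs₁₁ _ _)
  exact HasVertexMinor.of_locallyEquivalent hG' (hasVertexMinor_wheelGraph hn hc' htc'
    (Or.inr (Or.inr (Or.inr (by omega)))))

end Hub

/-! ### The case distinction -/

section Main

variable {V : Type u} {G : SimpleGraph V}

theorem ConnectedOn.of_walks {K : Finset V} (r : V)
    (h : ∀ y ∈ K, ∃ w : G.Walk y r, ∀ z ∈ w.support, z ∈ K) : ConnectedOn G K := by
  intro A hA hne hAK
  by_cases hr : r ∈ A
  · obtain ⟨b, hb, hbA⟩ : ∃ b ∈ K, b ∉ A := by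
      by_contra! hcon
      exact hAK (hA.antisymm hcon)
    obtain ⟨w, hw⟩ := h b hb
    obtain ⟨d, hd, h₁, h₂⟩ := w.exists_boundary_dart {z | z ∉ A} hbA (by simpa using hr)
    exact ⟨d.snd, by simpa using h₂, d.fst, hw _ (w.dart_fst_mem_support_of_mem_darts hd), h₁,
      d.adj.symm⟩
  · obtain ⟨a, ha⟩ := hne
    obtain ⟨w, hw⟩ := h a (hA ha)
    obtain ⟨d, hd, h₁, h₂⟩ := w.exists_boundary_dart (A : Set V) (by exact_mod_cast ha)
      (by exact_mod_cast hr)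
    exact ⟨d.fst, by exact_mod_cast h₁, d.snd, hw _ (w.dart_snd_mem_support_of_mem_darts hd),
      by exact_mod_cast h₂, d.adj⟩

open Classical in
/-- If every `s i` has a neighbour in `T` but no vertex of `T` has `C` or more neighbours among the
`s i`, then a minimal set of vertices of `T` dominating the `s i` is matched to many of them: every
vertex of the minimal set has a private neighbour. -/
theorem exists_induced_matching {ι : Type*} [Fintype ι] (s : ι → V) (T : Set V) (C : ℕ)
    (hT : ∀ i, ∃ t ∈ T, G.Adj (s i) t)
    (hC : ∀ t ∈ T, (Finset.univ.filter fun i => G.Adj t (s i)).card < C) :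
    ∃ (I : Finset ι) (x : ι → V), Fintype.card ι ≤ I.card * C ∧
      (∀ i ∈ I, x i ∈ T) ∧ ∀ i ∈ I, ∀ j ∈ I, (G.Adj (x i) (s j) ↔ i = j) := by
  choose f hfT hf using hT
  obtain ⟨U, hU, hUmin⟩ := Finset.exists_min_image
    ((Finset.univ.image f).powerset.filter fun U => ∀ i, ∃ t ∈ U, G.Adj (s i) t) Finset.card
    ⟨Finset.univ.image f, by
      simp only [Finset.mem_filter, Finset.mem_powerset, subset_rfl, true_and]
      exact fun i => ⟨f i, by simp, hf i⟩⟩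
  simp only [Finset.mem_filter, Finset.mem_powerset, and_imp] at hU hUmin
  have hUT : ∀ t ∈ U, t ∈ T := by
    intro t ht
    obtain ⟨i, -, rfl⟩ := Finset.mem_image.1 (hU.1 ht)
    exact hfT i
  have hpriv : ∀ t ∈ U, ∃ i, G.Adj t (s i) ∧ ∀ t' ∈ U, G.Adj t' (s i) → t' = t := by
    intro t ht
    by_contra! hcon
    have := hUmin (U.erase t) ((Finset.erase_subset _ _).trans hU.1) (by
      intro i
      obtain ⟨t', ht', hadj⟩ := hU.2 i
      by_cases h : t' = t
      · subst h
        obtain ⟨t'', h₁, h₂, h₃⟩ := hcon i hadj.symm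
        exact ⟨t'', Finset.mem_erase.2 ⟨h₃, h₁⟩, h₂.symm⟩
      · exact ⟨t', Finset.mem_erase.2 ⟨h, ht'⟩, hadj⟩)
    exact absurd (Finset.card_erase_lt_of_mem ht) (not_lt.2 this)
  rcases isEmpty_or_nonempty ι with hι | hι
  · exact ⟨∅, fun i => hι.elim i, by simp, by simp, by simp⟩
  choose! j hj hj' using hpriv
  have hjinj : Set.InjOn j U := fun t ht t' ht' e =>
    (hj' t' ht' t ht (e ▸ hj t ht))
  have hx : ∀ i, ∃ t, i ∈ U.image j → t ∈ U ∧ j t = i := by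
    intro i
    by_cases hi : i ∈ U.image j
    · obtain ⟨t, ht, e⟩ := Finset.mem_image.1 hi
      exact ⟨t, fun _ => ⟨ht, e⟩⟩
    · exact ⟨f i, fun h => absurd h hi⟩
  choose x hx using hx
  refine ⟨U.image j, x, ?_, fun i hi => hUT _ (hx i hi).1, ?_⟩
  · rw [Finset.card_image_of_injOn hjinj]
    have hsub : (Finset.univ : Finset ι) ⊆
        U.biUnion fun t => Finset.univ.filter fun i => G.Adj t (s i) := by
      intro i _
      obtain ⟨t, ht, hadj⟩ := hU.2 i
      exact Finset.mem_biUnion.2 ⟨t, ht, by simpa using hadj.symm⟩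
    exact (Finset.card_le_card hsub).trans (Finset.card_biUnion_le_card_mul _ _ _
      fun t ht => (hC t (hUT t ht)).le)
  · intro i hi k hk
    obtain ⟨h₁, h₂⟩ := hx i hi
    obtain ⟨h₃, h₄⟩ := hx k hk
    constructor
    · intro hadj
      have := hj' (x k) h₃ (x i) h₁ (by rwa [h₄])
      rw [← h₂, ← h₄, this]
    · rintro rfl
      have := hj (x i) h₁
      rwa [h₂] at this

end Main

end WheelVM

open WheelVM in
theorem mainTheorem2 (n : ℕ) (hn : 3 ≤ n) :
    ∃ M : ℕ, 0 < M ∧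
      ∀ (W : Type*) (V : Type*) (H : SimpleGraph W) (G : SimpleGraph V) (φ : H ↪g G)
        (m : ℕ) (q : Fin m → W) (s : Fin 2 → Fin M → W) (T : Fin 2 → Set V),
        WheelVM.IsSimplePatchedCycle H q s →
        WheelVM.IsRootedExtension φ q s T →
        WheelVM.HasVertexMinor G (WheelVM.wheelGraph n) := by
  classical
  obtain ⟨F₁, hF₁⟩ := exists_hasVertexMinor_of_hub hn
  obtain ⟨F₂, hF₂⟩ := exists_hasVertexMinor_of_matching hn
  refine ⟨(F₁ + 1) * (F₂ + 1), by positivity, ?_⟩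
  intro W V H G φ m q s T hH hG
  have hm := hH.three_le
  obtain ⟨b, hbmono, hb⟩ := hH.staircase
  set Q : ℕ → V := fun i => if h : i < m then φ (q ⟨i, h⟩) else φ (q ⟨0, by omega⟩) with hQdef
  have hQ : ∀ i (h : i < m), Q i = φ (q ⟨i, h⟩) := fun i h => by simp [hQdef, h]
  have hQc : IsInducedCycle G m Q := by
    refine ⟨hm, fun {i j} hi hj => ?_, fun {i j} hi hj => ?_⟩
    · rw [hQ i hi, hQ j hj, φ.injective.eq_iff, hH.cycle_injective.eq_iff, Fin.mk.injEq]
    · rw [hQ i hi, hQ j hj, φ.map_adj_iff, hH.cycle_adj, cycleGraph_adj_iff hm]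
  set S : Fin 2 → Fin ((F₁ + 1) * (F₂ + 1)) → V := fun i j => φ (s i j) with hS
  have hSb : ∀ i j, G.Adj (S i j) (Q (b j)) := fun i j => by
    rw [hQ _ (b j).2]; exact φ.map_adj_iff.2 (hb i j).1
  have hSb' : ∀ i j k, j < k → ¬ G.Adj (S i j) (Q (b k)) := fun i j k hjk => by
    rw [hQ _ (b k).2]; exact fun h => (hb i j).2 k hjk (φ.map_adj_iff.1 h)
  have hSS : ∀ i j i' j', ¬ G.Adj (S i j) (S i' j') := by
    intro i j i' j' h
    have h' : H.Adj (s i j) (s i' j') := φ.map_adj_iff.1 h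
    exact hH.independent (Set.mem_iUnion.2 ⟨i, j, rfl⟩) (Set.mem_iUnion.2 ⟨i', j', rfl⟩) h'.ne h'
  have hSQ : ∀ i j, ∀ k < m, S i j ≠ Q k := by
    intro i j k hk e
    rw [hQ k hk] at e
    exact Set.disjoint_left.1 (hH.disjoint_cycle i) ⟨⟨k, hk⟩, rfl⟩ ⟨j, φ.injective e⟩
  have hSne : ∀ j j', S 0 j ≠ S 1 j' := fun j j' e =>
    Set.disjoint_left.1 (hH.disjoint_patches 0 1 (by decide)) ⟨j, rfl⟩ ⟨j', (φ.injective e).symm⟩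
  have hS₁inj : Function.Injective (S 1) := φ.injective.comp (hH.patch_injective 1)
  have hTold : ∀ i, ∀ t ∈ T i, ∀ w, φ w ≠ t := fun i t ht w e =>
    Set.disjoint_left.1 (hG.disjoint_old i) ⟨w, rfl⟩ (e ▸ ht)
  have hTS : ∀ i, ∀ t ∈ T i, ∀ i' j, S i' j ≠ t := fun i t ht i' j => hTold i t ht _
  have hTQ : ∀ i, ∀ t ∈ T i, ∀ j < m, t ≠ Q j := fun i t ht j hj e => by
    rw [hQ j hj] at e; exact hTold i t ht _ e.symm
  have hTQ' : ∀ i, ∀ t ∈ T i, ∀ j < m, ¬ G.Adj (Q j) t := fun i t ht j hj => by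
    rw [hQ j hj]; exact hG.not_adj_cycle _ i t ht
  -- neighbours of the patches in `T i` are the vertices from which paths to the root are given
  have hnbr : ∀ i, ∀ t ∈ T i, (t ∈ setNeighbors G (Set.range fun j => φ (s i j)) ↔
      ∃ j, G.Adj (S i j) t) := by
    intro i t ht
    constructor
    · rintro ⟨-, _, ⟨j, rfl⟩, h⟩
      exact ⟨j, h⟩
    · rintro ⟨j, h⟩
      refine ⟨?_, _, ⟨j, rfl⟩, h⟩
      rintro ⟨k, hk⟩
      exact hTold i t ht _ hk
  by_cases hbig : ∃ t ∈ T 0, F₁ ≤ (Finset.univ.filter fun j => G.Adj t (S 0 j)).card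
  · obtain ⟨t, ht, htF⟩ := hbig
    obtain ⟨r, hr, hroot⟩ := hG.rooted 1
    refine hF₁ G Q (S 0) (S 1) (fun j => b j) _ t (T 1) hQc (fun j => (b j).2)
      (fun i j e => hbmono.injective (Fin.ext e)) (hSb 0) (hSb 1) (fun i j => hSS 0 i 0 j)
      (fun i j => hSS 0 i 1 j) (fun i j => hSS 1 i 1 j) (hSQ 0) (hSQ 1) hSne hS₁inj
      (fun j hj => (Finset.mem_filter.1 hj).2)
      (fun j hj h => hTQ' 0 t ht j hj h.symm) (hTQ 0 t ht) (fun j => (hTS 0 t ht 1 j).symm)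
      (fun h => Set.disjoint_left.1 hG.disjoint_new ht h) (hTQ' 1) (hTQ 1)
      (fun y hy j => hG.not_adj_patch j y hy) (fun y hy j => hTS 1 y hy 0 j) ?_ htF
    intro i j
    obtain ⟨y, hy, hiy⟩ := hG.patch_has_neighbor 1 i
    obtain ⟨z, hz, hjz⟩ := hG.patch_has_neighbor 1 j
    obtain ⟨P, -, hP, -⟩ := hroot y ⟨(hnbr 1 y hy).2 ⟨i, hiy⟩, hy⟩
    obtain ⟨P', -, hP', -⟩ := hroot z ⟨(hnbr 1 z hz).2 ⟨j, hjz⟩, hz⟩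
    refine ⟨.cons hiy (P.append (P'.reverse.append (.cons hjz.symm .nil))), ?_⟩
    intro x hx
    simp only [SimpleGraph.Walk.support_cons, List.mem_cons, SimpleGraph.Walk.mem_support_append_iff,
      SimpleGraph.Walk.support_reverse, List.mem_reverse, SimpleGraph.Walk.support_nil,
      List.not_mem_nil, or_false] at hx
    rcases hx with rfl | hx | hx | rfl | rfl
    · exact Or.inr (Or.inl rfl)
    · exact Or.inl (hP x hx)
    · exact Or.inl (hP' x hx)
    · exact Or.inl hz
    · exact Or.inr (Or.inr rfl)
  · push Not at hbig
    obtain ⟨r, hr, hroot⟩ := hG.rooted 0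
    obtain ⟨I, x, hI, hxT, hxs⟩ := exists_induced_matching (S 0) (T 0) F₁
      (fun j => hG.patch_has_neighbor 0 j) hbig
    rw [Fintype.card_fin] at hI
    -- the root is not adjacent to the patch: otherwise it would be adjacent to all of it
    have hrN : ∀ j, ¬ G.Adj (S 0 j) r := by
      intro j hj
      have hall : ∀ i, G.Adj r (S 0 i) := by
        intro i
        obtain ⟨y, hy, hiy⟩ := hG.patch_has_neighbor 0 i
        obtain ⟨P, -, -, hP⟩ := hroot y ⟨(hnbr 0 y hy).2 ⟨i, hiy⟩, hy⟩
        have : r ∈ ({y} : Set V) := hP ▸ ⟨(hnbr 0 r hr).2 ⟨j, hj⟩, P.end_mem_support⟩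
        rw [Set.mem_singleton_iff.1 this]
        exact hiy.symm
      have := hbig r hr
      rw [Finset.filter_true_of_mem fun i _ => hall i, Finset.card_univ, Fintype.card_fin] at this
      have : F₁ + 1 ≤ (F₁ + 1) * (F₂ + 1) := Nat.le_mul_of_pos_right _ (Nat.succ_pos _)
      omega
    -- the path from `x i` to the root, without its first vertex, avoids the neighbours of the patch
    have hpath : ∀ i : I, ∃ (y : V) (P : G.Walk y r), G.Adj (x i) y ∧
        ∀ z ∈ P.support, z ∈ T 0 ∧ ∀ j, ¬ G.Adj (S 0 j) z := by
      rintro ⟨i, hi⟩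
      have hxi : G.Adj (S 0 i) (x i) := ((hxs i hi i hi).2 rfl).symm
      obtain ⟨P, hPp, hPT, hPN⟩ := hroot (x i) ⟨(hnbr 0 _ (hxT i hi)).2 ⟨i, hxi⟩, hxT i hi⟩
      cases P with
      | nil => exact absurd hxi (hrN i)
      | @cons _ y _ h P =>
        refine ⟨y, P, h, fun z hz => ?_⟩
        have hz' : z ∈ (SimpleGraph.Walk.cons h P).support := by
          rw [SimpleGraph.Walk.support_cons]; exact List.mem_cons_of_mem _ hz
        refine ⟨hPT z hz', fun j hj => ?_⟩
        have : z ∈ ({x i} : Set V) := hPN ▸ ⟨(hnbr 0 z (hPT z hz')).2 ⟨j, hj⟩, hz'⟩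
        rw [Set.mem_singleton_iff.1 this] at hz
        exact ((SimpleGraph.Walk.cons_isPath_iff h P).1 hPp).2 hz
    choose y P hxy hP using hpath
    set K : Finset V := Finset.univ.biUnion fun i : I => (P i).support.toFinset with hK
    have hKmem : ∀ z, z ∈ K ↔ ∃ i : I, z ∈ (P i).support := by simp [hK]
    have hKT : ∀ z ∈ K, z ∈ T 0 ∧ ∀ j, ¬ G.Adj (S 0 j) z := by
      intro z hz
      obtain ⟨i, hi⟩ := (hKmem z).1 hz
      exact hP i z hi
    refine hF₂ G Q x (S 0) (fun j => b j) I K hQc (.of_walks r fun z hz => ?_)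
      (fun j _ => (b j).2) (fun i _ j _ e => hbmono.injective (Fin.ext e)) (fun j _ => hSb 0 j)
      (fun i _ j _ hij => hSb' 0 i j hij) (fun i _ j _ => hSS 0 i 0 j) hxs
      (fun i hi j hj h => hTQ' 0 _ (hxT i hi) j hj h.symm) (fun i hi => hTQ 0 _ (hxT i hi))
      (fun i _ => hSQ 0 i) (fun z hz j hj h => hTQ' 0 z (hKT z hz).1 j hj h.symm)
      (fun z hz => hTQ 0 z (hKT z hz).1) (fun z hz j _ h => (hKT z hz).2 j h.symm)
      (fun z hz j _ => (hTS 0 z (hKT z hz).1 0 j).symm) ?_ ?_ ?_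
    · obtain ⟨i, hi⟩ := (hKmem z).1 hz
      exact ⟨(P i).dropUntil z hi, fun w hw =>
        (hKmem w).2 ⟨i, (P i).support_dropUntil_subset_support hi hw⟩⟩
    · rintro z hz i hi rfl
      exact (hKT _ hz).2 i ((hxs i hi i hi).2 rfl).symm
    · intro i hi
      exact ⟨y ⟨i, hi⟩, (hKmem _).2 ⟨⟨i, hi⟩, (P ⟨i, hi⟩).start_mem_support⟩, hxy ⟨i, hi⟩⟩
    · by_contra! hlt
      have h₁ : I.card * F₁ ≤ F₂ * F₁ := Nat.mul_le_mul_right _ hlt.le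
      have h₂ : F₂ * F₁ < (F₁ + 1) * (F₂ + 1) := by nlinarith
      omega
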